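/- **Setting.** An $H$-step episodic process has a finite hidden state space $\mathcal S$, partitioned into levels $\mathcal S_1,\dots,\mathcal S_H$ with $M=\max_h|\mathcal S_h|$, a measurable observation space $\mathcal X$, and a finite non-empty set $\mathcal A$ of $K$ actions. The hidden dynamics are deterministic: a fixed initial state $s_1\in\mathcal S_1$ and a map $(s,a)\mapsto s\circ a$ from level $h$ to level $h+1$. At level $h$ the learner sees $x_h\sim O_{s_h}$, chooses $a_h$, and sees $r_h\sim R(x_h,a_h)$; each $x$ determines the hidden state (hence the level) that emits it, but this map and the hidden states are unknown to the learner. Almost surely, however actions are chosen, $r_h\ge 0$ and $\sum_h r_h\le 1$. A path $p\in\mathcal A^{h-1}$ leads to a hidden state of level $h$, and $x_h\sim p$ means that $x_h$ is emitted there. For a non-stationary policy $\pi=\pi_{1:H}$ (measurable $\pi_h:\mathcal X\to\mathcal A$) let $V^\pi=\mathbf E[\sum_h r_h\mid a_{1:H}\sim\pi]$ and $V^\star=\sup_\pi V^\pi$; for $x$ at level $h$ let $Q^\pi(x,a)=\mathbf E[\sum_{h'\ge h}r_{h'}\mid x_h=x,a_h=a,a_{h+1:H}\sim\pi]$ and $g^\star(x)=\sup_\pi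 Q^\pi(x,\pi_h(x))$. Let $\Pi$ be a finite class of measurable maps $\mathcal X\to\mathcal A$ and $\mathcal G$ a finite class of measurable maps $\mathcal X\to[0,1]$. **Assumptions.** *Policy completeness:* for each level $h$ and all $\pi_{h+1},\dots,\pi_H\in\Pi$ there is $\pi'\in\Pi$ with $\pi'(x)\in\arg\max_a Q^{\pi}(x,a)$ for all $x$ of level $h$. *Value realizability:* $g^\star\in\mathcal G$. **Algorithm (Global Policy).** Put $\tau=\tau_{val}=\tau_{pol}=\epsilon/(11H)$, $\phi_h=(H-h+1)(8\tau_{val}+3\tau_{pol})$, $T=3M^2HK$, $L=\log(16\,T M|\Pi||\mathcal G|/\delta)$, $n_{test}=\lceil L/(2\tau^2)\rceil$, $n_{train}=\lceil 16KL/\tau^2\rceil$. Each sample of a data set is one fresh trajectory; $\hat{\mathbf E}_D$ is the average over $D$; $\bar r=\sum_{h'\ge h}r_{h'}$. The algorithm maintains lists $\mathrm{Learned}(h)$, $\mathrm{Pruned}(h)$ of paths (initially empty) and policies $\hat\pi_h\in\Pi$ (initially arbitrary), calls $\mathrm{dfslearn}(\varnothing)$ on the empty path, and returns $\hat\pi_{1:H}$.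 $\mathrm{TestLearned}(p,h)$: collect $D$, $n_{test}$ samples $(x_h,\bar r)$ with $x_h\sim p$, $a_{h:H}\sim\hat\pi$. For each $q\in\mathrm{Learned}(h)$ in turn, collect $D'$ in the same way from $q$, let $V_{opt}=\max\{\hat{\mathbf E}_D[g(x_h)]: g\in\mathcal G,\ \hat{\mathbf E}_{D'}[g(x_h)-\bar r]\le\phi_h+2\tau_{val}\}$ ($-\infty$ if infeasible), and return true if $V_{opt}\le\hat{\mathbf E}_{D'}[\bar r]+\phi_h+4\tau_{val}$ and $\hat{\mathbf E}_D[\bar r]\ge\hat{\mathbf E}_{D'}[\bar r]-2\tau_{val}$. Return false if no $q$ succeeds. $\mathrm{dfslearn}(p)$, $h=|p|+1$: return at once if $h=H+1$. Unless called from step (iv), run $\mathrm{TestLearned}(p,h)$, and if it is true add $p$ to $\mathrm{Pruned}(h)$ and return. Otherwise: (i) call $\mathrm{dfslearn}(p\circ a)$ for each $a\in\mathcal A$; (ii) add $p$ to $\mathrm{Learned}(h)$ and, for each $q\in\mathrm{Learned}(h)$, collect $D_q$, $n_{train}$ samples $(x_h,a_h,\bar r)$ with $x_h\sim q$, $a_h$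 uniform, $a_{h+1:H}\sim\hat\pi$; (iii) set $\hat\pi_h$ to any $\pi\in\Pi$ such that for all $q\in\mathrm{Learned}(h)$, $\hat{\mathbf E}_{D_q}[K\mathbf 1\{a_h=\pi(x_h)\}\bar r]\ge\max_{\pi'\in\Pi}\hat{\mathbf E}_{D_q}[K\mathbf 1\{a_h=\pi'(x_h)\}\bar r]-2\tau_{pol}$ (any $\pi\in\Pi$ if there is none); (iv) for each $q\in\mathrm{Pruned}(h)$ (at the start of this loop, skipping paths that have meanwhile been removed), if $\mathrm{TestLearned}(q,h)$ is false, remove $q$ from $\mathrm{Pruned}(h)$ and call $\mathrm{dfslearn}(q)$. **Theorem.** There is a universal constant $C>0$ such that for every such process, all $\Pi,\mathcal G$ satisfying the two assumptions, all $\epsilon,\delta\in(0,1)$, every initial policy in $\Pi^H$ and every rule for the choice in (iii) (possibly depending on the data sets collected in (ii) and on the current lists and policies), with probability at least $1-\delta$ the Global Policy algorithm returns a policy $\hat\pi$ with $V^\star-V^{\hat\pi}\le\epsilon$ after collecting in total at most $$C\,\frac{M^3H^3K}{\epsilon^2}\,\log\!\left(\frac{2MHK|\Pi||\mathcal G|}{\delta}\right)=\tilde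 O\!\left(\frac{M^3H^3K}{\epsilon^2}\log\frac{|\Pi||\mathcal G|}{\delta}\right)$$ trajectories, where $\tilde O$ suppresses logarithmic factors in $M,H,K$. -/

import Mathlib

open MeasureTheory ProbabilityTheory

noncomputable section

namespace GlobalPolicy

/-! ### Rich-observation processes with deterministic hidden-state dynamics -/

/-- An `H`-step process with hidden states `S`, observations `X`, actions `A`, whose hidden-state
dynamics (initial state and transitions) are deterministic. Levels are numbered `0, …, H - 1`.
Every hidden state lives at one level, and it can in principle be identified from each observation
that it emits (`decode`; neither `decode` nor the hidden states are visible to the learner). -/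
structure RichProcess (S X A : Type*) [MeasurableSpace X] [MeasurableSpace A] (H : ℕ) where
  level : S → Fin H
  start : S
  level_start : (level start : ℕ) = 0
  next : S → A → S
  level_next : ∀ s a, (level s : ℕ) + 1 < H → (level (next s a) : ℕ) = level s + 1
  emit : S → Measure X
  emit_prob : ∀ s, IsProbabilityMeasure (emit s)
  decode : X → S
  emit_decode : ∀ s, ∀ᵐ x ∂(emit s), decode x = s
  reward : Kernel (X × A) ℝ
  reward_prob : IsMarkovKernel reward

/-- A (measurable) policy. A non-stationary policy is a sequence of policies, one for each level
(entries at indices `≥ H` are never used). -/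
abbrev Policy (X A : Type*) [MeasurableSpace X] [MeasurableSpace A] :=
  {π : X → A // Measurable π}

/-- What the learner sees of an episode: `((x_h, a_h), r_h)` for each level `h`. -/
abbrev Trajectory (X A : Type*) (H : ℕ) := Fin H → (X × A) × ℝ

section Environment

variable {S X A : Type*} [MeasurableSpace X] [MeasurableSpace A] {H : ℕ}

/-- The behaviour that follows the non-stationary policy `π`. -/
def follow (π : ℕ → Policy X A) (t : ℕ) : Kernel X A :=
  Kernel.deterministic (π t).1 (π t).2

instance (π : ℕ → Policy X A) (t : ℕ) : IsMarkovKernel (follow π t) := by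
  unfold follow; infer_instance

namespace RichProcess

variable (P : RichProcess S X A H)

instance (s : S) : IsProbabilityMeasure (P.emit s) := P.emit_prob s

instance : IsMarkovKernel P.reward := P.reward_prob

/-- The maximal number `M` of hidden states at one level. -/
def numStates : ℕ := Finset.univ.sup fun h : Fin H => Nat.card {s : S // P.level s = h}

/-- One step from the hidden state `s`: `x ∼ O_s`, `a ∼ κ(x)`, `r ∼ R(x, a)`. -/
def stepLaw (s : S) (κ : Kernel X A) : Measure ((X × A) × ℝ) :=
  ((P.emit s).compProd κ).compProd P.reward

instance (s : S) (κ : Kernel X A) [IsMarkovKernel κ] : IsProbabilityMeasure (P.stepLaw s κ) := by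
  unfold stepLaw; infer_instance

variable [Countable A] [MeasurableSingletonClass A]

/-- The law of the next `n` steps from the hidden state `s` at level `t`, where the action at
level `t'` is drawn from `β t'` given the current observation. -/
def episodeLaw (β : ℕ → Kernel X A) : (n t : ℕ) → S → Measure (Trajectory X A n)
  | 0, _, _ => Measure.dirac Fin.elim0
  | n + 1, t, s =>
    ((P.stepLaw s (β t)).compProd
      ((Kernel.ofFunOfCountable fun a => episodeLaw β n (t + 1) (P.next s a)).comap
        (fun z : (X × A) × ℝ => z.1.2) (measurable_snd.comp measurable_fst))).map
      fun w => (Fin.cons w.1 w.2 : Trajectory X A (n + 1))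

theorem episodeLaw_prob (β : ℕ → Kernel X A) [∀ t, IsMarkovKernel (β t)] (n t : ℕ) (s : S) :
    IsProbabilityMeasure (P.episodeLaw β n t s) := by
  induction n generalizing t s with
  | zero => unfold episodeLaw; infer_instance
  | succ n ih =>
    unfold episodeLaw
    have : IsMarkovKernel
        (Kernel.ofFunOfCountable fun a => P.episodeLaw β n (t + 1) (P.next s a)) :=
      ⟨fun a => ih (t + 1) (P.next s a)⟩
    refine Measure.isProbabilityMeasure_map (Measurable.aemeasurable ?_)
    refine measurable_pi_iff.2 fun i => ?_
    refine Fin.cases ?_ (fun j => ?_) i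
    · simpa using measurable_fst
    · simpa [Function.comp_def] using
        (measurable_pi_apply (X := fun _ : Fin n => (X × A) × ℝ) j).comp measurable_snd

/-- Almost surely, however the actions are chosen, the rewards of an episode are nonnegative and
sum up to at most `1`. -/
def RegularRewards : Prop :=
  ∀ β : ℕ → Kernel X A, (∀ t, IsMarkovKernel (β t)) →
    ∀ᵐ τ ∂(P.episodeLaw β H 0 P.start), (∀ i, 0 ≤ (τ i).2) ∧ ∑ i, (τ i).2 ≤ 1

/-- `E[∑_{h' ≥ t} r_{h'} | s_t = s, a_{t:H} ∼ π]`, for a hidden state `s` at level `t`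
(it is `0` for `t = H`). -/
def stateValue (π : ℕ → Policy X A) (t : ℕ) (s : S) : ℝ :=
  ∫ τ, ∑ i, (τ i).2 ∂(P.episodeLaw (follow π) (H - t) t s)

/-- The expected return `V^π`. -/
def value (π : ℕ → Policy X A) : ℝ := P.stateValue π 0 P.start

/-- The optimal value `V⋆`. -/
def optValue : ℝ := ⨆ π : ℕ → Policy X A, P.value π

/-- `Q^π(x, a) = E[∑_{h' ≥ h} r_{h'} | x_h = x, a_h = a, a_{h+1:H} ∼ π]`, with `h` the level of
`x`. -/
def qValue (π : ℕ → Policy X A) (x : X) (a : A) : ℝ :=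
  ∫ r, r ∂(P.reward (x, a)) +
    P.stateValue π (P.level (P.decode x) + 1) (P.next (P.decode x) a)

/-- `E[∑_{h' ≥ h} r_{h'} | x_h = x, a_{h:H} ∼ π]`, with `h` the level of `x`. -/
def obsValue (π : ℕ → Policy X A) (x : X) : ℝ :=
  P.qValue π x ((π (P.level (P.decode x))).1 x)

/-- The optimal value function `g⋆`. -/
def optValueFun (x : X) : ℝ := ⨆ π : ℕ → Policy X A, P.obsValue π x

/-- Policy completeness: for every level `h` and all choices of policies for the later levels, some
policy in `Pi` picks at each observation of level `h` an action that is optimal when the later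
actions are taken by the given policies. -/
def PolicyComplete (Pi : Finset (Policy X A)) : Prop :=
  ∀ (h : Fin H) (π : ℕ → Policy X A), (∀ h' : Fin H, h < h' → π h' ∈ Pi) →
    ∃ π' ∈ Pi, ∀ x, P.level (P.decode x) = h → ∀ a, P.qValue π x a ≤ P.qValue π x (π'.1 x)

/-- Value realizability: `g⋆ ∈ G`. -/
def ValueRealizable (G : Finset (X → ℝ)) : Prop := P.optValueFun ∈ G

end RichProcess

end Environment

/-! ### Interactive programs -/

/-- How an episode is run: take the actions in `path`; then, if `explore`, one uniformly random
action; from then on follow `pol`. -/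
structure Query (X A : Type*) [MeasurableSpace X] [MeasurableSpace A] where
  path : List A
  explore : Bool
  pol : ℕ → Policy X A

/-- The behaviour prescribed by a query. -/
def Query.behaviour {X A : Type*} [MeasurableSpace X] [MeasurableSpace A] [Fintype A] [Nonempty A]
    (q : Query X A) (t : ℕ) : Kernel X A :=
  if ht : t < q.path.length then Kernel.const X (Measure.dirac q.path[t])
  else if q.explore = true ∧ t = q.path.length then
    Kernel.const X (PMF.uniformOfFintype A).toMeasure
  else follow q.pol t

instance {X A : Type*} [MeasurableSpace X] [MeasurableSpace A] [Fintype A] [Nonempty A]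
    (q : Query X A) (t : ℕ) : IsMarkovKernel (q.behaviour t) := by
  unfold Query.behaviour
  split_ifs <;> infer_instance

/-- Programs of a learner that interacts with an unknown process. `collect n q k` runs `n`
independent episodes as prescribed by `q` and continues with `k` applied to the observed
trajectories; `diverge` never returns. -/
inductive Prog (X A : Type*) [MeasurableSpace X] [MeasurableSpace A] (H : ℕ) (α : Type*)
  | ret (a : α) : Prog X A H α
  | diverge : Prog X A H α
  | collect (n : ℕ) (q : Query X A) (k : (Fin n → Trajectory X A H) → Prog X A H α) : Prog X A H α

namespace Prog

variable {X A : Type*} [MeasurableSpace X] [MeasurableSpace A] {H : ℕ}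

/-- Sequential composition. -/
def bind {α β : Type*} : Prog X A H α → (α → Prog X A H β) → Prog X A H β
  | ret a, f => f a
  | diverge, _ => diverge
  | collect n q k, f => collect n q fun D => (k D).bind f

/-- `for i in l do f i`, acting on a state. -/
def forEach {ι σ : Type*} : List ι → (ι → σ → Prog X A H σ) → σ → Prog X A H σ
  | [], _, st => ret st
  | i :: l, f, st => (f i st).bind (forEach l f)

open Classical in
/-- The probability, when the program is run in the process `P` after `N` episodes have already
been used up, that it returns some `a` after `N'` episodes in total with `Good a N'`. The integrals
are Lebesgue integrals of nonnegative functions, which for a non-measurable integrand are lower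
integrals, so that a lower bound on `prob` is meaningful for all programs. -/
def prob [Fintype A] [Nonempty A] [MeasurableSingletonClass A] {S α : Type*}
    (P : RichProcess S X A H) (Good : α → ℕ → Prop) : Prog X A H α → ℕ → ENNReal
  | ret a, N => if Good a N then 1 else 0
  | diverge, _ => 0
  | collect n q k, N =>
    ∫⁻ D, prob P Good (k D) (N + n)
      ∂(Measure.pi fun _ : Fin n => P.episodeLaw q.behaviour H 0 P.start)

end Prog

/-! ### The Global Policy algorithm -/

/-- Sizes of the data sets and tolerances used by the algorithm. -/
structure Params where
  nTrain : ℕ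
  nTest : ℕ
  τpol : ℝ
  τval : ℝ
  φ : ℕ → ℝ

/-- The global variables: the learned and pruned paths and the current policy of each level. -/
structure GState (X A : Type*) [MeasurableSpace X] [MeasurableSpace A] where
  learned : ℕ → List (List A)
  pruned : ℕ → List (List A)
  pol : ℕ → Policy X A

section Algorithm

variable {X A : Type*} [MeasurableSpace X] [MeasurableSpace A] {H : ℕ}

/-- The empirical expectation of `f` over a data set. -/
def empMean {n : ℕ} (D : Fin n → Trajectory X A H) (f : Trajectory X A H → ℝ) : ℝ :=
  (∑ i, f (D i)) / n

/-- The observation `x_h`. -/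
def obs (h : Fin H) (τ : Trajectory X A H) : X := (τ h).1.1

/-- The return `∑_{h' ≥ h} r_{h'}` from level `h` on. -/
def retFrom (h : Fin H) (τ : Trajectory X A H) : ℝ := ∑ i ∈ Finset.Ici h, (τ i).2

open Classical in
/-- The value `max_{g ∈ G} E_D[g(x_h)]  s.t.  E_{D'}[g(x_h) - r̄] ≤ φ_h + 2 τ_val`
(`⊥` if infeasible). -/
def vOpt (prm : Params) (G : Finset (X → ℝ)) (h : Fin H)
    (D D' : Fin prm.nTest → Trajectory X A H) : WithBot ℝ :=
  (G.filter fun g => empMean D' (fun τ => g (obs h τ) - retFrom h τ)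
      ≤ prm.φ h + 2 * prm.τval).sup
    fun g => ((empMean D fun τ => g (obs h τ) : ℝ) : WithBot ℝ)

/-- The state-identity test for one learned path. -/
def SameState (prm : Params) (G : Finset (X → ℝ)) (h : Fin H)
    (D D' : Fin prm.nTest → Trajectory X A H) : Prop :=
  vOpt prm G h D D' ≤ ((empMean D' (retFrom h) + prm.φ h + 4 * prm.τval : ℝ) : WithBot ℝ) ∧
    empMean D' (retFrom h) - 2 * prm.τval ≤ empMean D (retFrom h)

open Classical in
/-- The loop of `TestLearned` over the learned paths. -/
def testAgainst (prm : Params) (G : Finset (X → ℝ)) (pol : ℕ → Policy X A) (h : Fin H)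
    (D : Fin prm.nTest → Trajectory X A H) : List (List A) → Prog X A H Bool
  | [] => .ret false
  | q :: qs => .collect prm.nTest ⟨q, false, pol⟩ fun D' =>
      if SameState prm G h D D' then .ret true else testAgainst prm G pol h D qs

/-- `TestLearned(p, h)`. -/
def testLearned (prm : Params) (G : Finset (X → ℝ)) (st : GState X A) (h : Fin H) (p : List A) :
    Prog X A H Bool :=
  .collect prm.nTest ⟨p, false, st.pol⟩ fun D => testAgainst prm G st.pol h D (st.learned h)

/-- Collects the training data sets `D_q` of the paths `q` in a list. -/
def collectTrain (n : ℕ) (pol : ℕ → Policy X A) :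
    List (List A) → Prog X A H (List (Fin n → Trajectory X A H))
  | [] => .ret []
  | q :: qs => .collect n ⟨q, true, pol⟩ fun D =>
      (collectTrain n pol qs).bind fun Ds => .ret (D :: Ds)

variable [Fintype A]

open Classical in
/-- `E_D[K 1{a_h = π(x_h)} r̄]`. -/
def ipsValue {n : ℕ} (h : Fin H) (D : Fin n → Trajectory X A H) (π : Policy X A) : ℝ :=
  empMean D fun τ =>
    Fintype.card A * (if (τ h).1.2 = π.1 (obs h τ) then 1 else 0) * retFrom h τ

/-- The condition on the new policy `π` of level `h`: on each data set its estimated value is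
within `2 τ_pol` of the best one in the class. -/
def Fits (prm : Params) (Pi : Finset (Policy X A)) (h : Fin H)
    (Ds : List (Fin prm.nTrain → Trajectory X A H)) (π : Policy X A) : Prop :=
  ∀ D ∈ Ds, (⨆ π' : Pi, ipsValue h D π'.1) - 2 * prm.τpol ≤ ipsValue h D π

/-- A rule by which the algorithm picks "any policy" in `Pi` that fits the data sets. It may depend
on the data sets and the global variables in any way, and is only constrained when some policy in
`Pi` fits. -/
def IsFitRule (prm : Params) (Pi : Finset (Policy X A))
    (fit : GState X A → (h : Fin H) → List (Fin prm.nTrain → Trajectory X A H) → Policy X A) :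
    Prop :=
  ∀ st h Ds, fit st h Ds ∈ Pi ∧
    ((∃ π ∈ Pi, Fits prm Pi h Ds π) → Fits prm Pi h Ds (fit st h Ds))

open Classical in
/-- `dfslearn(p)`, with recursion depth limited by the first argument. The flag tells whether the
call comes from the re-check of pruned paths (then the initial test is skipped). Paths of
length `H` have no level left, and the call returns at once. The loop over the pruned paths runs
through the paths that are pruned when the loop starts, skipping those that have meanwhile been
removed by a recursive call. -/
def dfslearn (prm : Params) (Pi : Finset (Policy X A)) (G : Finset (X → ℝ))
    (fit : GState X A → (h : Fin H) → List (Fin prm.nTrain → Trajectory X A H) → Policy X A) :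
    ℕ → Bool → List A → GState X A → Prog X A H (GState X A)
  | 0, _, _, _ => .diverge
  | fuel + 1, recheck, p, st =>
    if hp : p.length < H then
      let h : Fin H := ⟨p.length, hp⟩
      (if recheck then .ret false else testLearned prm G st h p).bind fun same =>
      if same then
        .ret { st with pruned := Function.update st.pruned h (p :: st.pruned h) }
      else
        (Prog.forEach (Finset.univ : Finset A).toList
          (fun a st => dfslearn prm Pi G fit fuel false (p ++ [a]) st) st).bind fun st₁ =>
        let st₂ : GState X A :=
          { st₁ with learned := Function.update st₁.learned h (p :: st₁.learned h) }
        (collectTrain prm.nTrain st₂.pol (st₂.learned h)).bind fun Ds =>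
        let st₃ : GState X A := { st₂ with pol := Function.update st₂.pol h (fit st₂ h Ds) }
        Prog.forEach (st₃.pruned h)
          (fun q st =>
            if q ∈ st.pruned h then
              (testLearned prm G st h q).bind fun same =>
              if same then .ret st
              else dfslearn prm Pi G fit fuel true q
                { st with pruned :=
                    Function.update st.pruned h ((st.pruned h).filter fun q' => q' ≠ q) }
            else .ret st) st₃
    else .ret st

/-- The algorithm, with recursion depth limited by `fuel`: it starts without learned and pruned
paths and with an arbitrary policy, calls `dfslearn` on the empty path and returns the policy. -/
def main (prm : Params) (Pi : Finset (Policy X A)) (G : Finset (X → ℝ))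
    (fit : GState X A → (h : Fin H) → List (Fin prm.nTrain → Trajectory X A H) → Policy X A)
    (pol₀ : ℕ → Policy X A) (fuel : ℕ) : Prog X A H (ℕ → Policy X A) :=
  (dfslearn prm Pi G fit fuel false [] ⟨fun _ => [], fun _ => [], pol₀⟩).bind fun st =>
    .ret st.pol

/-- The probability that the algorithm (without limit on the recursion depth), run in the
process `P`, returns some `π` after `N` trajectories in total with `Good π N`. -/
def successProb [Nonempty A] [MeasurableSingletonClass A] {S : Type*} (P : RichProcess S X A H)
    (prm : Params) (Pi : Finset (Policy X A)) (G : Finset (X → ℝ))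
    (fit : GState X A → (h : Fin H) → List (Fin prm.nTrain → Trajectory X A H) → Policy X A)
    (pol₀ : ℕ → Policy X A) (Good : (ℕ → Policy X A) → ℕ → Prop) : ENNReal :=
  ⨆ fuel, (main prm Pi G fit pol₀ fuel).prob P Good 0

end Algorithm

/-- The parameters with which the algorithm is run, for `M` hidden states per level, horizon `H`,
`K` actions, classes with `NPi` policies and `NG` value functions, accuracy `ε` and confidence
`1 - δ`:
`τ_pol = τ_val = ε / (11 H)`, `φ_h = (H - h) (8 τ_val + 3 τ_pol)` for `h = 0, …, H - 1`,
`T_max = 3 M² H K`, `n_test = ⌈log(16 T_max M NPi NG / δ) / (2 τ_val²)⌉`,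
`n_train = ⌈16 K log(16 T_max M NPi NG / δ) / τ_pol²⌉`. -/
def params (M H K NPi NG : ℕ) (ε δ : ℝ) : Params :=
  let τ : ℝ := ε / (11 * H)
  let Tmax : ℝ := 3 * M ^ 2 * H * K
  let L : ℝ := Real.log (16 * Tmax * M * NPi * NG / δ)
  { nTrain := ⌈16 * K * L / τ ^ 2⌉₊
    nTest := ⌈L / (2 * τ ^ 2)⌉₊
    τpol := τ
    τval := τ
    φ := fun h => ((H : ℝ) - h) * (8 * τ + 3 * τ) }

end GlobalPolicy

end

/-! The proof separates sampling from search. Outside an event of probability at most `η`, each data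
set is accurate: a test set estimates the return and the mean of every `g ∈ G` within `τval`
(Hoeffding), and a training set estimates, within `τpol / 2`, the value of every `π' ∈ Pi` used at
the current level (Bernstein; importance weights have range `K`, but a second moment of order `K`
only). `Setup` records this. `Prog.Ensures` carries it through programs, and `Ensures.le_prob`
yields probability at least `1 - B * η` if no good run uses more than `B` data sets.

On accurate data the analysis is deterministic. Two paths to the same hidden state always pass the
test (`sameState_of_stateOf_eq`), so a path that fails against all learned ones reaches a new state,
and a level has at most `M` learned paths. Conversely, if `p` passes against a path whose gap to the
optimum is at most `φ h`, then `p` has gap at most `φ h + 8 τval` (`gap_le_of_sameState`): `g⋆` is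
feasible in the optimization, so `vOpt` bounds the optimal value at `p`. The two states may well
differ; only the loss matters. Training adds `3 τpol` (`Setup.gap_fit_le`): by completeness one
policy is greedy at all observations of a level, hence best at all its hidden states simultaneously.
This gives the recursion `φ h = φ (h + 1) + 8 τval + 3 τpol`, and `φ 0 = ε`.

The search maintains that all is well from the current level on (`GoodFrom`). Retraining a level
spoils what was known about its pruned paths, which are therefore re-checked, and about earlier
levels, which the pending calls retrain later. Every call past its test learns a new hidden state,
so at most `H * M` paths are learned. Each of them pays for the `K` tests of its successors, one
round of training and at most `K * M` re-checks; this bounds the data sets and trajectories. The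
same growth of the learned lists bounds the recursion depth. -/

noncomputable section

namespace GlobalPolicy

open scoped ENNReal

set_option linter.unusedSectionVars false

/-! ### Laws of episodes with deterministic hidden dynamics -/

section EpisodeLaw

variable {S X A : Type*} [MeasurableSpace X] [MeasurableSpace A] {H : ℕ}

namespace RichProcess

variable (P : RichProcess S X A H) [Countable A] [MeasurableSingletonClass A]

theorem measurable_trajectory_cons (n : ℕ) :
    Measurable fun w : ((X × A) × ℝ) × Trajectory X A n =>
      (Fin.cons w.1 w.2 : Trajectory X A (n + 1)) := by
  refine measurable_pi_iff.2 fun i => ?_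
  refine Fin.cases ?_ (fun j => ?_) i
  · simpa using measurable_fst
  · simpa [Function.comp_def] using
      (measurable_pi_apply (X := fun _ : Fin n => (X × A) × ℝ) j).comp measurable_snd

/-- The law of an episode decomposes into the first step and the remaining ones. -/
theorem lintegral_episodeLaw_succ (β : ℕ → Kernel X A) [∀ t, IsMarkovKernel (β t)] (n t : ℕ)
    (s : S) {f : Trajectory X A (n + 1) → ℝ≥0∞} (hf : Measurable f) :
    ∫⁻ τ, f τ ∂(P.episodeLaw β (n + 1) t s) =
      ∫⁻ x, ∫⁻ a, ∫⁻ r, ∫⁻ τ, f (Fin.cons ((x, a), r) τ)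
        ∂(P.episodeLaw β n (t + 1) (P.next s a)) ∂(P.reward (x, a)) ∂(β t x) ∂(P.emit s) := by
  have hK : IsMarkovKernel
      (Kernel.ofFunOfCountable fun a => P.episodeLaw β n (t + 1) (P.next s a)) :=
    ⟨fun a => P.episodeLaw_prob β n (t + 1) (P.next s a)⟩
  have hc := measurable_trajectory_cons (X := X) (A := A) n
  have hg : Measurable fun w : ((X × A) × ℝ) × Trajectory X A n => f (Fin.cons w.1 w.2) :=
    hf.comp hc
  rw [episodeLaw, lintegral_map hf hc, Measure.lintegral_compProd hg, stepLaw,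
    Measure.lintegral_compProd (hg.lintegral_kernel_prod_right),
    Measure.lintegral_compProd]
  · rfl
  · exact (hg.lintegral_kernel_prod_right).lintegral_kernel_prod_right

/-- The law of an episode from level `t` on only depends on the behaviour from level `t` on. -/
theorem episodeLaw_congr {β β' : ℕ → Kernel X A} (n t : ℕ) (s : S)
    (h : ∀ t', t ≤ t' → β t' = β' t') : P.episodeLaw β n t s = P.episodeLaw β' n t s := by
  induction n generalizing t s with
  | zero => simp [episodeLaw]
  | succ n ih =>
    simp only [episodeLaw]
    rw [h t le_rfl]
    have : (fun a => P.episodeLaw β n (t + 1) (P.next s a)) =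
        fun a => P.episodeLaw β' n (t + 1) (P.next s a) :=
      funext fun a => ih (t + 1) _ fun t' ht' => h t' (by omega)
    rw [this]

theorem measurable_trajectory_tail (n : ℕ) :
    Measurable (Fin.tail : Trajectory X A (n + 1) → Trajectory X A n) :=
  measurable_pi_iff.2 fun i => measurable_pi_apply i.succ

/-- A forced action determines the next hidden state, so the first step integrates out and no
conditioning is needed. -/
theorem map_tail_episodeLaw {β : ℕ → Kernel X A} [∀ t, IsMarkovKernel (β t)] (n t : ℕ) (s : S)
    (a : A) (h : β t = Kernel.const X (Measure.dirac a)) :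
    (P.episodeLaw β (n + 1) t s).map Fin.tail = P.episodeLaw β n (t + 1) (P.next s a) := by
  have := P.episodeLaw_prob β n (t + 1) (P.next s a)
  refine Measure.ext_of_lintegral _ fun f hf => ?_
  have ht := measurable_trajectory_tail (X := X) (A := A) n
  rw [lintegral_map hf ht, P.lintegral_episodeLaw_succ β n t s (f := fun τ => f (Fin.tail τ)) (hf.comp ht)]
  simp [h, lintegral_dirac]

/-- Dropping the first `p.length` steps. -/
theorem map_drop_episodeLaw {β : ℕ → Kernel X A} [∀ t, IsMarkovKernel (β t)] (p : List A) :
    ∀ (n m t : ℕ) (s : S) (hn : n = p.length + m),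
      (∀ i (hi : i < p.length), β (t + i) = Kernel.const X (Measure.dirac p[i])) →
      (P.episodeLaw β n t s).map
          (fun τ (i : Fin m) => τ ⟨p.length + i, by have := i.2; omega⟩) =
        P.episodeLaw β m (t + p.length) (p.foldl P.next s) := by
  induction p with
  | nil =>
    intro n m t s hn _
    obtain rfl : n = m := by simpa using hn
    simp
  | cons a p ih =>
    intro n m t s hn hβ
    obtain ⟨n, rfl⟩ : ∃ n', n = n' + 1 := ⟨p.length + m, by simp at hn; omega⟩
    have h1 := ih n m (t + 1) (P.next s a) (by simp at hn; omega) (fun i hi => by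
      have := hβ (i + 1) (by simpa using hi)
      rw [show t + 1 + i = t + (i + 1) by omega, this]; simp)
    rw [← P.map_tail_episodeLaw n t s a (hβ 0 (by simp)),
      Measure.map_map (measurable_pi_iff.2 fun i => measurable_pi_apply _)
        (measurable_trajectory_tail n)] at h1
    simp only [List.foldl_cons, List.length_cons]
    rw [show t + (p.length + 1) = t + 1 + p.length by omega, ← h1]
    congr 1
    funext τ i
    simp only [Function.comp, Fin.tail]
    congr 1
    ext
    simp; omega

/-- The return collected in `n` steps. -/
def totalReturn {n : ℕ} (τ : Trajectory X A n) : ℝ := ∑ i, (τ i).2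

theorem measurable_totalReturn {n : ℕ} :
    Measurable (totalReturn : Trajectory X A n → ℝ) :=
  Finset.measurable_sum _ fun i _ => measurable_snd.comp (measurable_pi_apply i)

/-- The rewards of an episode are nonnegative with sum at most one. -/
def Bounded {n : ℕ} (τ : Trajectory X A n) : Prop := (∀ i, 0 ≤ (τ i).2) ∧ totalReturn τ ≤ 1

theorem measurableSet_bounded {n : ℕ} : MeasurableSet {τ : Trajectory X A n | Bounded τ} := by
  have h1 : MeasurableSet {τ : Trajectory X A n | ∀ i, 0 ≤ (τ i).2} := by
    simp only [Set.ofPred_forall]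
    exact MeasurableSet.iInter fun i =>
      measurableSet_le measurable_const (measurable_snd.comp (measurable_pi_apply i))
  exact h1.inter (measurableSet_le measurable_totalReturn measurable_const)

theorem Bounded.nonneg {n : ℕ} {τ : Trajectory X A n} (h : Bounded τ) : 0 ≤ totalReturn τ :=
  Finset.sum_nonneg fun i _ => h.1 i

theorem totalReturn_succ {n : ℕ} (τ : Trajectory X A (n + 1)) :
    totalReturn τ = (τ 0).2 + totalReturn (Fin.tail τ) := by
  simp [totalReturn, Fin.sum_univ_succ, Fin.tail]

theorem Bounded.tail {n : ℕ} {τ : Trajectory X A (n + 1)} (h : Bounded τ) :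
    Bounded (Fin.tail τ) := by
  refine ⟨fun i => h.1 i.succ, ?_⟩
  have := h.2
  rw [totalReturn_succ] at this
  linarith [h.1 0]

/-- Rewards are almost surely bounded in the next `n` steps from the hidden state `s` at
level `t`. -/
def RegularAt (n t : ℕ) (s : S) : Prop :=
  ∀ β : ℕ → Kernel X A, (∀ t, IsMarkovKernel (β t)) → ∀ᵐ τ ∂(P.episodeLaw β n t s), Bounded τ

variable {P}

/-- Regularity holds for all behaviours, in particular for one that is forced to play `a` at level
`t`. Dropping its nonnegative first reward keeps the sum below one. -/
theorem RegularAt.next {n t : ℕ} {s : S} (h : P.RegularAt (n + 1) t s) (a : A) :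
    P.RegularAt n (t + 1) (P.next s a) := by
  intro β hβ
  set β' : ℕ → Kernel X A := Function.update β t (Kernel.const X (Measure.dirac a)) with hβ'
  have hM : ∀ t', IsMarkovKernel (β' t') := by
    intro t'
    by_cases e : t' = t
    · subst e; rw [hβ', Function.update_self]; infer_instance
    · rw [hβ', Function.update_of_ne e]; infer_instance
  rw [P.episodeLaw_congr (β := β) (β' := β') _ _ _ fun t' ht' => by
      rw [hβ', Function.update_of_ne (by omega)],
    ← P.map_tail_episodeLaw (β := β') _ t s a (by rw [hβ', Function.update_self]),
    ae_map_iff (measurable_trajectory_tail _).aemeasurable measurableSet_bounded]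
  filter_upwards [h β' hM] with τ hτ using hτ.tail

variable (P) in
/-- The hidden state to which a path leads. -/
def stateOf (p : List A) : S := p.foldl P.next P.start

@[simp]
theorem stateOf_append_singleton (p : List A) (a : A) :
    P.stateOf (p ++ [a]) = P.next (P.stateOf p) a := by
  simp [stateOf]

theorem level_stateOf (p : List A) (hp : p.length < H) :
    (P.level (P.stateOf p) : ℕ) = p.length := by
  induction p using List.reverseRecOn with
  | nil => simpa [stateOf] using P.level_start
  | append_singleton p a ih =>
    simp only [List.length_append, List.length_singleton] at hp ⊢
    rw [stateOf_append_singleton, P.level_next _ _ (by rw [ih (by omega)]; exact hp),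
      ih (by omega)]

/-- Boundedness is assumed for whole episodes only; it descends to the states reached by paths.
Other states need not be regular. -/
theorem RegularRewards.regularAt (h : P.RegularRewards) (p : List A) :
    ∀ n, H = p.length + n → P.RegularAt n p.length (P.stateOf p) := by
  induction p using List.reverseRecOn with
  | nil =>
    intro n hn
    obtain rfl : H = n := by simpa using hn
    exact fun β hβ => h β hβ
  | append_singleton p a ih =>
    intro n hn
    simp only [List.length_append, List.length_singleton] at hn
    simpa using (ih (n + 1) (by omega)).next a

end RichProcess

end EpisodeLaw

/-! ### Expected returns and the Bellman equation -/

section Values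

variable {S X A : Type*} [MeasurableSpace X] [MeasurableSpace A] {H : ℕ}

namespace RichProcess

variable {P : RichProcess S X A H} [Countable A] [MeasurableSingletonClass A]

/-- Episode laws are decomposed by Lebesgue integrals, which need no integrability; this is the
bridge back to expectations. -/
theorem ofReal_integral_of_ae_mem_Icc {Ω : Type*} [MeasurableSpace Ω] {μ : Measure Ω}
    [IsFiniteMeasure μ] {f : Ω → ℝ} {b : ℝ} (hm : AEMeasurable f μ)
    (h : ∀ᵐ ω ∂μ, f ω ∈ Set.Icc 0 b) :
    ENNReal.ofReal (∫ ω, f ω ∂μ) = ∫⁻ ω, ENNReal.ofReal (f ω) ∂μ :=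
  ofReal_integral_eq_lintegral_ofReal (Integrable.of_mem_Icc 0 b hm h)
    (h.mono fun _ hω => hω.1)

theorem integral_mem_Icc {Ω : Type*} [MeasurableSpace Ω] {μ : Measure Ω}
    [IsProbabilityMeasure μ] {f : Ω → ℝ} {b : ℝ} (hm : AEMeasurable f μ)
    (h : ∀ᵐ ω ∂μ, f ω ∈ Set.Icc 0 b) : ∫ ω, f ω ∂μ ∈ Set.Icc 0 b := by
  refine ⟨integral_nonneg_of_ae (h.mono fun _ hω => hω.1), ?_⟩
  calc ∫ ω, f ω ∂μ ≤ ∫ _, b ∂μ :=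
        integral_mono_ae (Integrable.of_mem_Icc 0 b hm h) (integrable_const _)
          (h.mono fun _ hω => hω.2)
    _ = b := by simp

theorem RegularAt.ae_mem_Icc {n t : ℕ} {s : S} (h : P.RegularAt n t s) (β : ℕ → Kernel X A)
    [hβ : ∀ t, IsMarkovKernel (β t)] :
    ∀ᵐ τ ∂(P.episodeLaw β n t s), totalReturn τ ∈ Set.Icc (0 : ℝ) 1 :=
  (h β hβ).mono fun _ hτ => ⟨hτ.nonneg, hτ.2⟩

/-- Single rewards are almost surely bounded, whichever action is taken. -/
theorem RegularAt.reward_mem_Icc {n t : ℕ} {s : S} (h : P.RegularAt (n + 1) t s) :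
    ∀ᵐ x ∂(P.emit s), ∀ a, ∀ᵐ r ∂(P.reward (x, a)), r ∈ Set.Icc (0 : ℝ) 1 := by
  rw [ae_all_iff]
  intro a
  -- Under constant play of `a`, the probability that the first reward leaves `[0, 1]` is an
  -- integral over `x` of the reward kernel. It vanishes, hence so does the integrand almost
  -- everywhere.
  set β : ℕ → Kernel X A := fun _ => Kernel.const X (Measure.dirac a)
  have hB : ∀ᵐ τ ∂(P.episodeLaw β (n + 1) t s), (τ 0).2 ∈ Set.Icc (0 : ℝ) 1 := by
    filter_upwards [h β fun t => inferInstance] with τ hτ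
    have h2 := hτ.2
    rw [totalReturn_succ] at h2
    exact ⟨hτ.1 0, by linarith [hτ.tail.nonneg]⟩
  have hm0 : Measurable fun τ : Trajectory X A (n + 1) => (τ 0).2 :=
    measurable_snd.comp (measurable_pi_apply 0)
  have hI : MeasurableSet (Set.Icc (0 : ℝ) 1)ᶜ := measurableSet_Icc.compl
  have hind : Measurable (Set.indicator (Set.Icc (0 : ℝ) 1)ᶜ (1 : ℝ → ℝ≥0∞)) :=
    measurable_one.indicator hI
  have h0 : ∫⁻ τ, Set.indicator (Set.Icc (0 : ℝ) 1)ᶜ (1 : ℝ → ℝ≥0∞) (τ 0).2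
      ∂(P.episodeLaw β (n + 1) t s) = 0 := by
    refine (lintegral_eq_zero_iff (hind.comp hm0)).2 ?_
    filter_upwards [hB] with τ hτ
    exact Set.indicator_of_notMem (Set.notMem_compl_iff.2 hτ) _
  rw [P.lintegral_episodeLaw_succ β n t s
    (f := fun τ => Set.indicator (Set.Icc (0 : ℝ) 1)ᶜ (1 : ℝ → ℝ≥0∞) (τ 0).2)
    (hind.comp hm0)] at h0
  have := fun a => P.episodeLaw_prob β n (t + 1) (P.next s a)
  simp only [Fin.cons_zero, lintegral_const, measure_univ, mul_one, β, Kernel.const_apply,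
    lintegral_dirac, lintegral_indicator_one hI] at h0
  rw [lintegral_eq_zero_iff] at h0
  · filter_upwards [h0] with x hx
    exact hx
  · exact (Kernel.measurable_coe P.reward hI).comp (by fun_prop)

/-- The expected reward for taking the action `a` at the observation `x`. -/
def meanReward (P : RichProcess S X A H) (x : X) (a : A) : ℝ := ∫ r, r ∂(P.reward (x, a))

theorem measurable_meanReward : Measurable fun z : X × A => P.meanReward z.1 z.2 :=
  (stronglyMeasurable_id.integral_kernel (κ := P.reward)).measurable

theorem RegularAt.meanReward_mem_Icc {n t : ℕ} {s : S} (h : P.RegularAt (n + 1) t s) :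
    ∀ᵐ x ∂(P.emit s), ∀ a, P.meanReward x a ∈ Set.Icc (0 : ℝ) 1 := by
  filter_upwards [h.reward_mem_Icc] with x hx a
  exact integral_mem_Icc (f := fun r => r) aemeasurable_id (hx a)

/-- The expected return of the next `n` steps. -/
def expReturn (P : RichProcess S X A H) (π : ℕ → Policy X A) (n t : ℕ) (s : S) : ℝ :=
  ∫ τ, totalReturn τ ∂(P.episodeLaw (follow π) n t s)

theorem stateValue_eq_expReturn (π : ℕ → Policy X A) {n t : ℕ} (hn : H = t + n) (s : S) :
    P.stateValue π t s = P.expReturn π n t s := by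
  obtain rfl : n = H - t := by omega
  rfl

theorem expReturn_congr {π π' : ℕ → Policy X A} (n t : ℕ) (s : S)
    (h : ∀ t', t ≤ t' → π t' = π' t') : P.expReturn π n t s = P.expReturn π' n t s := by
  unfold expReturn
  rw [P.episodeLaw_congr (β := follow π) (β' := follow π') n t s fun t' ht' => by
    simp only [follow, h t' ht']]

theorem stateValue_congr {π π' : ℕ → Policy X A} (t : ℕ) (s : S)
    (h : ∀ t', t ≤ t' → π t' = π' t') : P.stateValue π t s = P.stateValue π' t s :=
  expReturn_congr (H - t) t s h

theorem RegularAt.expReturn_mem_Icc {n t : ℕ} {s : S} (h : P.RegularAt n t s)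
    (π : ℕ → Policy X A) : P.expReturn π n t s ∈ Set.Icc (0 : ℝ) 1 := by
  have := P.episodeLaw_prob (follow π) n t s
  exact integral_mem_Icc measurable_totalReturn.aemeasurable (h.ae_mem_Icc _)

theorem RegularAt.ofReal_expReturn {n t : ℕ} {s : S} (h : P.RegularAt n t s)
    (π : ℕ → Policy X A) : ENNReal.ofReal (P.expReturn π n t s) =
      ∫⁻ τ, ENNReal.ofReal (totalReturn τ) ∂(P.episodeLaw (follow π) n t s) := by
  have := P.episodeLaw_prob (follow π) n t s
  exact ofReal_integral_of_ae_mem_Icc measurable_totalReturn.aemeasurable (h.ae_mem_Icc _)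

theorem lintegral_follow {π : ℕ → Policy X A} (n t : ℕ) (s : S)
    {f : Trajectory X A (n + 1) → ℝ≥0∞} (hf : Measurable f) :
    ∫⁻ τ, f τ ∂(P.episodeLaw (follow π) (n + 1) t s) =
      ∫⁻ x, ∫⁻ r, ∫⁻ τ, f (Fin.cons ((x, (π t).1 x), r) τ)
        ∂(P.episodeLaw (follow π) n (t + 1) (P.next s ((π t).1 x)))
        ∂(P.reward (x, (π t).1 x)) ∂(P.emit s) := by
  rw [P.lintegral_episodeLaw_succ _ n t s hf]
  simp [follow, Kernel.deterministic_apply, lintegral_dirac]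

/-- The Bellman equation. -/
theorem RegularAt.expReturn_succ {n t : ℕ} {s : S} (h : P.RegularAt (n + 1) t s)
    (π : ℕ → Policy X A) :
    P.expReturn π (n + 1) t s = ∫ x, (P.meanReward x ((π t).1 x) +
      P.expReturn π n (t + 1) (P.next s ((π t).1 x))) ∂(P.emit s) := by
  have hE : ∀ a, P.expReturn π n (t + 1) (P.next s a) ∈ Set.Icc (0 : ℝ) 1 := fun a =>
    (h.next a).expReturn_mem_Icc π
  have hm0 : Measurable fun τ : Trajectory X A (n + 1) => ENNReal.ofReal (τ 0).2 :=
    (measurable_snd.comp (measurable_pi_apply 0)).ennreal_ofReal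
  have hm1 : Measurable fun τ : Trajectory X A (n + 1) =>
      ENNReal.ofReal (totalReturn (Fin.tail τ)) :=
    (measurable_totalReturn.comp (measurable_trajectory_tail n)).ennreal_ofReal
  have hf1 : Measurable fun x => P.meanReward x ((π t).1 x) :=
    measurable_meanReward.comp (measurable_id.prodMk (π t).2)
  have hf2 : Measurable fun x => P.expReturn π n (t + 1) (P.next s ((π t).1 x)) :=
    (measurable_of_countable fun a => P.expReturn π n (t + 1) (P.next s a)).comp (π t).2
  -- The return splits into first reward and tail, both nonnegative almost surely, so the identity
  -- can be proved in `ℝ≥0∞` and transferred afterwards.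
  have key : ENNReal.ofReal (P.expReturn π (n + 1) t s) =
      ∫⁻ x, ENNReal.ofReal (P.meanReward x ((π t).1 x) +
        P.expReturn π n (t + 1) (P.next s ((π t).1 x))) ∂(P.emit s) := by
    rw [h.ofReal_expReturn]
    calc ∫⁻ τ, ENNReal.ofReal (totalReturn τ) ∂(P.episodeLaw (follow π) (n + 1) t s)
        = ∫⁻ τ, (ENNReal.ofReal (τ 0).2 + ENNReal.ofReal (totalReturn (Fin.tail τ)))
            ∂(P.episodeLaw (follow π) (n + 1) t s) := by
          refine lintegral_congr_ae ?_
          filter_upwards [h (follow π) fun t => inferInstance] with τ hτ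
          rw [totalReturn_succ, ENNReal.ofReal_add (hτ.1 0) hτ.tail.nonneg]
      _ = _ := by
          rw [lintegral_add_left hm0, lintegral_follow n t s hm0, lintegral_follow n t s hm1,
            ← lintegral_add_right]
          · refine lintegral_congr_ae ?_
            filter_upwards [h.meanReward_mem_Icc, h.reward_mem_Icc] with x hx hx'
            have := fun a => P.episodeLaw_prob (follow π) n (t + 1) (P.next s a)
            simp only [Fin.cons_zero, Fin.tail_cons, lintegral_const, measure_univ, mul_one]
            rw [← (h.next _).ofReal_expReturn, ENNReal.ofReal_add (hx _).1 (hE _).1]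
            congr 1
            exact (ofReal_integral_of_ae_mem_Icc (f := fun r => r) aemeasurable_id (hx' _)).symm
          · simp only [Fin.tail_cons, lintegral_const, measure_univ, mul_one]
            exact (measurable_of_countable fun a => ∫⁻ τ, ENNReal.ofReal (totalReturn τ)
              ∂(P.episodeLaw (follow π) n (t + 1) (P.next s a))).comp (π t).2
  have h2 : ∀ᵐ x ∂(P.emit s), P.meanReward x ((π t).1 x) +
      P.expReturn π n (t + 1) (P.next s ((π t).1 x)) ∈ Set.Icc (0 : ℝ) 2 := by
    filter_upwards [h.meanReward_mem_Icc] with x hx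
    exact ⟨add_nonneg (hx _).1 (hE _).1, by linarith [(hx ((π t).1 x)).2, (hE ((π t).1 x)).2]⟩
  have h3 := ofReal_integral_of_ae_mem_Icc (hf1.add hf2).aemeasurable h2
  simp only [Pi.add_apply] at h3
  rw [← h3] at key
  exact (ENNReal.ofReal_eq_ofReal_iff (h.expReturn_mem_Icc π).1
    (integral_nonneg_of_ae (h2.mono fun _ hx => hx.1))).1 key

/-! ### Optimal values -/

/-- Observations of `s` decode to `s` almost surely. The null set does not depend on `π` or `a`,
which permits suprema over uncountably many policies under the integral. -/
theorem ae_qValue_eq {t n : ℕ} (hn : H = t + (n + 1)) {s : S} (hl : (P.level s : ℕ) = t) :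
    ∀ᵐ x ∂(P.emit s), (P.level (P.decode x) : ℕ) = t ∧ ∀ (π : ℕ → Policy X A) a,
      P.qValue π x a = P.meanReward x a + P.expReturn π n (t + 1) (P.next s a) := by
  filter_upwards [P.emit_decode s] with x hx
  rw [hx, hl]
  refine ⟨rfl, fun π a => ?_⟩
  rw [qValue, hx, hl, stateValue_eq_expReturn π (n := n) (by omega)]
  rfl

/-- The crude bound `2` (at most one for each summand) serves only for integrability and to make the
supremum defining `g⋆` bounded. -/
theorem RegularAt.ae_obsValue {t n : ℕ} {s : S} (h : P.RegularAt (n + 1) t s)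
    (hn : H = t + (n + 1)) (hl : (P.level s : ℕ) = t) :
    ∀ᵐ x ∂(P.emit s), ∀ π : ℕ → Policy X A, P.obsValue π x = P.meanReward x ((π t).1 x) +
      P.expReturn π n (t + 1) (P.next s ((π t).1 x)) ∧ P.obsValue π x ∈ Set.Icc (0 : ℝ) 2 := by
  filter_upwards [ae_qValue_eq hn hl, h.meanReward_mem_Icc] with x hx hx' π
  have e : P.obsValue π x = P.meanReward x ((π t).1 x) +
      P.expReturn π n (t + 1) (P.next s ((π t).1 x)) := by
    rw [obsValue, hx.2, hx.1]
  have hE := fun a => (h.next a).expReturn_mem_Icc π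
  refine ⟨e, ?_⟩
  rw [e]
  exact ⟨add_nonneg (hx' _).1 (hE _).1, by linarith [(hx' ((π t).1 x)).2, (hE ((π t).1 x)).2]⟩

theorem measurable_bellman (π : ℕ → Policy X A) (n t : ℕ) (s : S) :
    Measurable fun x => P.meanReward x ((π t).1 x) +
      P.expReturn π n (t + 1) (P.next s ((π t).1 x)) :=
  (measurable_meanReward.comp (measurable_id.prodMk (π t).2)).add
    ((measurable_of_countable fun a => P.expReturn π n (t + 1) (P.next s a)).comp (π t).2)

/-- The optimal value at a hidden state. -/
def optState (P : RichProcess S X A H) (s : S) : ℝ := ∫ x, P.optValueFun x ∂(P.emit s)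

theorem RegularAt.stateValue_le_optState {t n : ℕ} {s : S} (h : P.RegularAt (n + 1) t s)
    (hn : H = t + (n + 1)) (hl : (P.level s : ℕ) = t) (hm : Measurable P.optValueFun)
    (hb : ∀ x, P.optValueFun x ∈ Set.Icc (0 : ℝ) 1) (π : ℕ → Policy X A) :
    P.stateValue π t s ≤ P.optState s := by
  rw [stateValue_eq_expReturn π hn, h.expReturn_succ, optState]
  have hae := h.ae_obsValue hn hl
  refine integral_mono_ae (Integrable.of_mem_Icc 0 2 (measurable_bellman π n t s).aemeasurable ?_)
    (Integrable.of_mem_Icc 0 1 hm.aemeasurable (Filter.Eventually.of_forall hb)) ?_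
  · filter_upwards [hae] with x hx
    rw [← (hx π).1]
    exact (hx π).2
  · filter_upwards [hae] with x hx
    rw [← (hx π).1]
    exact le_ciSup (f := fun π : ℕ → Policy X A => P.obsValue π x)
      ⟨2, by rintro _ ⟨π', rfl⟩; exact (hx π').2.2⟩ π

/-- Acting greedily with respect to later policies that are `B`-optimal is `B`-optimal. -/
theorem RegularAt.optState_le_of_greedy {t n : ℕ} {s : S} (h : P.RegularAt (n + 1) t s)
    (hn : H = t + (n + 1)) (hl : (P.level s : ℕ) = t) (hm : Measurable P.optValueFun)
    (hb : ∀ x, P.optValueFun x ∈ Set.Icc (0 : ℝ) 1) (π : ℕ → Policy X A) (π' : Policy X A)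
    (hπ' : ∀ x, (P.level (P.decode x) : ℕ) = t → ∀ a, P.qValue π x a ≤ P.qValue π x (π'.1 x))
    {B : ℝ} (hB : ∀ a (π'' : ℕ → Policy X A), P.stateValue π'' (t + 1) (P.next s a) ≤
      P.stateValue π (t + 1) (P.next s a) + B) :
    P.optState s ≤ P.stateValue (Function.update π t π') t s + B := by
  set ρ := Function.update π t π' with hρ
  have hρt : ρ t = π' := Function.update_self ..
  have hae := h.ae_obsValue hn hl
  have hi : Integrable (fun x => P.meanReward x ((ρ t).1 x) +
      P.expReturn ρ n (t + 1) (P.next s ((ρ t).1 x))) (P.emit s) := by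
    refine Integrable.of_mem_Icc 0 2 (measurable_bellman ρ n t s).aemeasurable ?_
    filter_upwards [hae] with x hx
    rw [← (hx ρ).1]
    exact (hx ρ).2
  rw [stateValue_eq_expReturn ρ hn, h.expReturn_succ, optState]
  calc ∫ x, P.optValueFun x ∂(P.emit s) ≤ ∫ x, (P.meanReward x ((ρ t).1 x) +
      P.expReturn ρ n (t + 1) (P.next s ((ρ t).1 x)) + B) ∂(P.emit s) := by
        refine integral_mono_ae
          (Integrable.of_mem_Icc 0 1 hm.aemeasurable (Filter.Eventually.of_forall hb))
          (hi.add (integrable_const B)) ?_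
        filter_upwards [hae, ae_qValue_eq hn hl] with x hx hq
        have : Nonempty (ℕ → Policy X A) := ⟨π⟩
        refine ciSup_le fun π'' => ?_
        have h1 := hB ((π'' t).1 x) π''
        rw [stateValue_eq_expReturn _ (n := n) (by omega),
          stateValue_eq_expReturn _ (n := n) (by omega)] at h1
        have h2 := hπ' x hq.1 ((π'' t).1 x)
        rw [hq.2, hq.2] at h2
        have h3 : P.expReturn ρ n (t + 1) (P.next s ((ρ t).1 x)) =
            P.expReturn π n (t + 1) (P.next s ((ρ t).1 x)) :=
          expReturn_congr _ _ _ fun t' ht' => Function.update_of_ne (by omega) _ _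
        rw [(hx π'').1, h3, hρt]
        linarith
    _ = _ := by rw [integral_add hi (integrable_const B)]; simp

end RichProcess

end Values

/-! ### What the data sets of a query estimate -/

section Queries

variable {S X A : Type*} [MeasurableSpace X] [MeasurableSpace A] {H : ℕ}

namespace RichProcess

/-- The steps of an episode from level `k` on. -/
def dropSteps {k n : ℕ} (hn : H = k + n) (τ : Trajectory X A H) : Trajectory X A n :=
  fun i => τ ⟨k + i, by have := i.2; omega⟩

theorem measurable_dropSteps {k n : ℕ} (hn : H = k + n) :
    Measurable (dropSteps hn : Trajectory X A H → Trajectory X A n) :=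
  measurable_pi_iff.2 fun _ => measurable_pi_apply _

theorem measurable_retFrom (h : Fin H) : Measurable (retFrom h : Trajectory X A H → ℝ) :=
  Finset.measurable_sum _ fun i _ => measurable_snd.comp (measurable_pi_apply i)

theorem measurable_obs (h : Fin H) : Measurable (obs h : Trajectory X A H → X) :=
  measurable_fst.comp (measurable_fst.comp (measurable_pi_apply h))

theorem retFrom_eq {k n : ℕ} (h : Fin H) (hk : k = h) (hn : H = k + n) (τ : Trajectory X A H) :
    retFrom h τ = totalReturn (dropSteps hn τ) := by
  unfold retFrom totalReturn dropSteps
  refine (Finset.sum_bij (fun (i : Fin n) _ => (⟨k + i, by have := i.2; omega⟩ : Fin H))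
    (fun i _ => by simp [Fin.le_def, hk]) (fun i _ j _ e => by simpa [Fin.ext_iff] using e)
    (fun j hj => ?_) (fun i _ => rfl)).symm
  have h1 : (h : ℕ) ≤ j := Fin.le_def.1 (Finset.mem_Ici.1 hj)
  exact ⟨⟨j - k, by have := j.2; omega⟩, Finset.mem_univ _, Fin.ext (by simp; omega)⟩

theorem dropSteps_zero {k n : ℕ} (h : Fin H) (hk : k = h) (hn : H = k + (n + 1))
    (τ : Trajectory X A H) : dropSteps hn τ 0 = τ h := by
  subst hk
  simp [dropSteps]

variable {P : RichProcess S X A H} [Fintype A] [Nonempty A] [MeasurableSingletonClass A]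

/-- The law of a single episode run as prescribed by a query. -/
def queryLaw (P : RichProcess S X A H) (q : Query X A) : Measure (Trajectory X A H) :=
  P.episodeLaw q.behaviour H 0 P.start

instance (q : Query X A) : IsProbabilityMeasure (P.queryLaw q) :=
  P.episodeLaw_prob _ _ _ _

theorem map_dropSteps_queryLaw (q : Query X A) {n : ℕ} (hn : H = q.path.length + n) :
    (P.queryLaw q).map (dropSteps hn) =
      P.episodeLaw q.behaviour n q.path.length (P.stateOf q.path) := by
  have := P.map_drop_episodeLaw (β := q.behaviour) q.path H n 0 P.start hn fun i hi => by
    rw [zero_add]; simp [Query.behaviour, hi]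
  rw [zero_add] at this
  exact this

theorem episodeLaw_behaviour (p : List A) (π : ℕ → Policy X A) (n : ℕ) (s : S) :
    P.episodeLaw (Query.behaviour ⟨p, false, π⟩) n p.length s =
      P.episodeLaw (follow π) n p.length s :=
  P.episodeLaw_congr _ _ _ fun t ht => by simp [Query.behaviour, not_lt.2 ht]

/-- Importance weighting turns uniform exploration at the first step into following `π t`. -/
theorem lintegral_uniform (p : List A) (π : ℕ → Policy X A) (n : ℕ) (s : S) (π' : Policy X A)
    {f : Trajectory X A (n + 1) → ℝ≥0∞} (hf : Measurable f) :
    ∫⁻ τ, {τ : Trajectory X A (n + 1) | (τ 0).1.2 = π'.1 (τ 0).1.1}.indicator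
        (fun τ => Fintype.card A * f τ) τ
        ∂(P.episodeLaw (Query.behaviour ⟨p, true, π⟩) (n + 1) p.length s) =
      ∫⁻ τ, f τ ∂(P.episodeLaw (follow (Function.update π p.length π')) (n + 1) p.length s) := by
  have hm : MeasurableSet {τ : Trajectory X A (n + 1) | (τ 0).1.2 = π'.1 (τ 0).1.1} :=
    measurableSet_eq_fun
      (measurable_snd.comp (measurable_fst.comp (measurable_pi_apply 0)))
      (π'.2.comp (measurable_fst.comp (measurable_fst.comp (measurable_pi_apply 0))))
  rw [P.lintegral_episodeLaw_succ _ _ _ _ ((hf.const_mul _).indicator hm), lintegral_follow _ _ _ hf]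
  refine lintegral_congr fun x => ?_
  have hb : Query.behaviour (⟨p, true, π⟩ : Query X A) p.length =
      Kernel.const X (PMF.uniformOfFintype A).toMeasure := by
    simp [Query.behaviour]
  have hu : ∀ F : A → ℝ≥0∞, ∫⁻ a, F a ∂(PMF.uniformOfFintype A).toMeasure =
      ∑ a, F a * (Fintype.card A : ℝ≥0∞)⁻¹ := by
    intro F
    rw [lintegral_fintype]
    refine Finset.sum_congr rfl fun a _ => ?_
    rw [PMF.toMeasure_apply_singleton _ _ (measurableSet_singleton a),
      PMF.uniformOfFintype_apply]
  -- Only the action `π' x` survives the indicator, and its weight `K` cancels its probability `1 /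
  -- K`.
  rw [hb, Kernel.const_apply, hu, Function.update_self, Finset.sum_eq_single (π'.1 x)]
  · rw [P.episodeLaw_congr (β := Query.behaviour ⟨p, true, π⟩)
      (β' := follow (Function.update π p.length π')) n (p.length + 1) _ fun t ht => by
        have h2 : ¬ t < p.length := by omega
        have h3 : t ≠ p.length := by omega
        simp [Query.behaviour, h2, h3, follow]]
    have hmk : Measurable fun w : ℝ × Trajectory X A n =>
        f (Fin.cons ((x, π'.1 x), w.1) w.2) :=
      hf.comp ((measurable_trajectory_cons n).comp
        ((measurable_const.prodMk measurable_fst).prodMk measurable_snd))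
    have := P.episodeLaw_prob (follow (Function.update π p.length π')) n (p.length + 1)
      (P.next s (π'.1 x))
    simp only [Set.indicator, Set.mem_ofPred_eq, Fin.cons_zero, if_true]
    have hin : ∀ r : ℝ, Measurable fun τ : Trajectory X A n =>
        f (Fin.cons ((x, π'.1 x), r) τ) := fun r => hmk.comp measurable_prodMk_left
    simp_rw [lintegral_const_mul _ (hin _)]
    rw [lintegral_const_mul _ hmk.lintegral_prod_right', mul_comm, ← mul_assoc,
      ENNReal.inv_mul_cancel (by simp) (by simp), one_mul]
  · intro a _ ha
    simp [Set.indicator, ha]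
  · simp

theorem RegularRewards.ae_retFrom {P : RichProcess S X A H} (hP : P.RegularRewards) (q : Query X A)
    (h : Fin H) (hq : q.path.length = h) :
    ∀ᵐ τ ∂(P.queryLaw q), retFrom h τ ∈ Set.Icc (0 : ℝ) 1 := by
  have hn : H = q.path.length + (H - q.path.length) := by omega
  have h1 := hP.regularAt q.path _ hn q.behaviour fun t => inferInstance
  rw [← map_dropSteps_queryLaw q hn,
    ae_map_iff (measurable_dropSteps hn).aemeasurable measurableSet_bounded] at h1
  filter_upwards [h1] with τ hτ
  rw [retFrom_eq h hq hn]
  exact ⟨hτ.nonneg, hτ.2⟩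

/-- Following `π` after a path has the value of `π` at the hidden state reached. -/
theorem integral_retFrom (p : List A) (π : ℕ → Policy X A) (h : Fin H) (hp : p.length = h) :
    ∫ τ, retFrom h τ ∂(P.queryLaw ⟨p, false, π⟩) = P.stateValue π h (P.stateOf p) := by
  have hn : H = p.length + (H - p.length) := by omega
  have h1 := map_dropSteps_queryLaw (P := P) ⟨p, false, π⟩ hn
  rw [episodeLaw_behaviour] at h1
  rw [← hp, stateValue_eq_expReturn π hn, expReturn, ← h1,
    integral_map (measurable_dropSteps _).aemeasurable
      measurable_totalReturn.aestronglyMeasurable]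
  refine integral_congr_ae (Filter.Eventually.of_forall fun τ => ?_)
  exact retFrom_eq h hp hn τ

theorem integral_obs (q : Query X A) (h : Fin H) (hq : q.path.length = h) {g : X → ℝ}
    (hg : Measurable g) :
    ∫ τ, g (obs h τ) ∂(P.queryLaw q) = ∫ x, g x ∂(P.emit (P.stateOf q.path)) := by
  obtain ⟨n, hn⟩ : ∃ n, H = q.path.length + (n + 1) := ⟨H - q.path.length - 1, by omega⟩
  have key : (P.queryLaw q).map (obs h) = P.emit (P.stateOf q.path) := by
    refine Measure.ext_of_lintegral _ fun f hf => ?_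
    rw [lintegral_map hf (measurable_obs h)]
    have hm : Measurable fun τ : Trajectory X A (n + 1) => f (τ 0).1.1 :=
      hf.comp (measurable_fst.comp (measurable_fst.comp (measurable_pi_apply 0)))
    have h1 : ∀ τ : Trajectory X A H, f (obs h τ) = f (dropSteps hn τ 0).1.1 := fun τ => by
      rw [dropSteps_zero h hq hn, obs]
    simp_rw [h1]
    rw [← lintegral_map hm (measurable_dropSteps hn), map_dropSteps_queryLaw,
      P.lintegral_episodeLaw_succ _ _ _ _ hm]
    have := fun a => P.episodeLaw_prob q.behaviour n (q.path.length + 1)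
      (P.next (P.stateOf q.path) a)
    simp
  rw [← key, integral_map (measurable_obs h).aemeasurable hg.aestronglyMeasurable]

open Classical in
/-- The importance-weighted return. -/
def ipsReturn (h : Fin H) (π : Policy X A) (τ : Trajectory X A H) : ℝ :=
  Fintype.card A * (if (τ h).1.2 = π.1 (obs h τ) then 1 else 0) * retFrom h τ

theorem measurable_ipsReturn (h : Fin H) (π : Policy X A) :
    Measurable (ipsReturn h π : Trajectory X A H → ℝ) := by
  classical
  refine Measurable.mul (measurable_const.mul (Measurable.ite ?_ measurable_const measurable_const))
    (measurable_retFrom h)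
  exact measurableSet_eq_fun (measurable_snd.comp (measurable_fst.comp (measurable_pi_apply h)))
    (π.2.comp (measurable_obs h))

theorem RegularRewards.ae_ipsReturn {P : RichProcess S X A H} (hP : P.RegularRewards)
    (q : Query X A) (h : Fin H) (hq : q.path.length = h) (π : Policy X A) :
    ∀ᵐ τ ∂(P.queryLaw q), ipsReturn h π τ ∈ Set.Icc (0 : ℝ) (Fintype.card A) := by
  filter_upwards [hP.ae_retFrom q h hq] with τ hτ
  have hK : (0 : ℝ) ≤ Fintype.card A := Nat.cast_nonneg _
  unfold ipsReturn
  split_ifs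
  · rw [mul_one]
    exact ⟨mul_nonneg hK hτ.1, mul_le_of_le_one_right hK hτ.2⟩
  · simp

/-- Unbiasedness of importance weighting: one exploratory data set evaluates every candidate policy
for level `h`, with the later policies kept. -/
theorem RegularRewards.integral_ipsReturn {P : RichProcess S X A H} (hP : P.RegularRewards)
    (p : List A) (π : ℕ → Policy X A) (h : Fin H) (hp : p.length = h) (π' : Policy X A) :
    ∫ τ, ipsReturn h π' τ ∂(P.queryLaw ⟨p, true, π⟩) =
      P.stateValue (Function.update π h π') h (P.stateOf p) := by
  obtain ⟨n, hn⟩ : ∃ n, H = p.length + (n + 1) := ⟨H - p.length - 1, by omega⟩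
  have hr := hP.regularAt p _ hn
  have hmr : Measurable fun τ : Trajectory X A (n + 1) => ENNReal.ofReal (totalReturn τ) :=
    measurable_totalReturn.ennreal_ofReal
  have h1 := lintegral_uniform (P := P) p π n (P.stateOf p) π' hmr
  have hm : MeasurableSet {τ : Trajectory X A (n + 1) | (τ 0).1.2 = π'.1 (τ 0).1.1} :=
    measurableSet_eq_fun
      (measurable_snd.comp (measurable_fst.comp (measurable_pi_apply 0)))
      (π'.2.comp (measurable_fst.comp (measurable_fst.comp (measurable_pi_apply 0))))
  rw [← hr.ofReal_expReturn, ← map_dropSteps_queryLaw (P := P) ⟨p, true, π⟩ hn,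
    lintegral_map ((hmr.const_mul _).indicator hm) (measurable_dropSteps _)] at h1
  have h2 := ofReal_integral_of_ae_mem_Icc (measurable_ipsReturn h π').aemeasurable
    (hP.ae_ipsReturn ⟨p, true, π⟩ h hp π')
  have h0 := (hr.expReturn_mem_Icc (Function.update π p.length π')).1
  rw [← hp, stateValue_eq_expReturn _ hn, ← ENNReal.ofReal_eq_ofReal_iff _ h0, ← h1, h2]
  · refine lintegral_congr fun τ => ?_
    have e1 := dropSteps_zero h hp hn τ
    have e2 := retFrom_eq h hp hn τ
    by_cases hc : (τ h).1.2 = π'.1 (obs h τ)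
    · rw [Set.indicator_of_mem (by rw [Set.mem_ofPred_eq, e1]; exact hc), ipsReturn, if_pos hc,
        mul_one, ENNReal.ofReal_mul (by positivity), ENNReal.ofReal_natCast, e2]
    · rw [Set.indicator_of_notMem (by rw [Set.mem_ofPred_eq, e1]; exact hc), ipsReturn, if_neg hc]
      simp
  · exact (integral_mem_Icc (measurable_ipsReturn h π').aemeasurable
      (hP.ae_ipsReturn ⟨p, true, π⟩ h hp π')).1

end RichProcess

end Queries

/-! ### Chernoff, Hoeffding and Bernstein bounds for sample means -/

section Concentration

variable {Ω : Type*} [MeasurableSpace Ω] {μ : Measure Ω} [IsProbabilityMeasure μ]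

/-- Markov's inequality for the exponential of the sum, whose moment generating function factors by
independence. A bound at the single point `l` suffices. -/
theorem pi_sum_ge_le {Z : Ω → ℝ} (hZ : Measurable Z) {l c : ℝ} (hl : 0 ≤ l)
    (hi : Integrable (fun ω => Real.exp (l * Z ω)) μ) (hmgf : mgf Z μ l ≤ Real.exp c) (n : ℕ)
    (ρ : ℝ) :
    (Measure.pi fun _ : Fin n => μ) {D | n * ρ ≤ ∑ i, Z (D i)} ≤
      ENNReal.ofReal (Real.exp (n * (c - l * ρ))) := by
  set ν := Measure.pi fun _ : Fin n => μ
  have hmp : ∀ i : Fin n, MeasurePreserving (fun D : Fin n → Ω => D i) ν μ := fun i =>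
    measurePreserving_eval (fun _ : Fin n => μ) i
  have hind : iIndepFun (fun (i : Fin n) (D : Fin n → Ω) => Z (D i)) ν :=
    iIndepFun_pi (X := fun _ => Z) fun _ => hZ.aemeasurable
  have hme : ∀ i : Fin n, Measurable fun D : Fin n → Ω => Z (D i) := fun i =>
    hZ.comp (measurable_pi_apply i)
  have hint : ∀ i : Fin n, Integrable (fun D : Fin n → Ω => Real.exp (l * Z (D i))) ν := fun i =>
    (hmp i).integrable_comp_of_integrable hi
  have h1 := measure_ge_le_exp_mul_mgf (μ := ν) (X := ∑ i, fun D : Fin n → Ω => Z (D i)) (n * ρ) hl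
    (hind.integrable_exp_mul_sum hme fun i _ => hint i)
  rw [hind.mgf_sum hme] at h1
  have h2 : ∀ i : Fin n, mgf (fun D : Fin n → Ω => Z (D i)) ν l = mgf Z μ l := fun i => by
    rw [mgf, mgf, ← (hmp i).map_eq, integral_map (hmp i).measurable.aemeasurable]
    rw [(hmp i).map_eq]
    exact hi.aestronglyMeasurable
  rw [Finset.prod_congr rfl fun i _ => h2 i, Finset.prod_const, Finset.card_univ,
    Fintype.card_fin] at h1
  have h3 : Real.exp (-l * (n * ρ)) * mgf Z μ l ^ n ≤ Real.exp (n * (c - l * ρ)) := by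
    calc _ ≤ Real.exp (-l * (n * ρ)) * Real.exp c ^ n := by
          gcongr
          exact mgf_nonneg
      _ = _ := by rw [← Real.exp_nat_mul, ← Real.exp_add]; ring_nf
  have h4 := ENNReal.ofReal_le_ofReal (h1.trans h3)
  rw [Measure.real, ENNReal.ofReal_toReal (measure_ne_top _ _)] at h4
  simpa [Finset.sum_apply] using h4

/-- A two-sided Chernoff bound for the mean of a sample. -/
theorem pi_mean_deviation_le {Y : Ω → ℝ} (hY : Measurable Y) {b : ℝ}
    (hb : ∀ᵐ ω ∂μ, Y ω ∈ Set.Icc 0 b) {l c : ℝ} (hl : 0 ≤ l)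
    (h1 : mgf (fun ω => Y ω - ∫ ω, Y ω ∂μ) μ l ≤ Real.exp c)
    (h2 : mgf (fun ω => Y ω - ∫ ω, Y ω ∂μ) μ (-l) ≤ Real.exp c) {n : ℕ} (hn : 0 < n) (ρ : ℝ) :
    (Measure.pi fun _ : Fin n => μ) {D | ρ ≤ |(∑ i, Y (D i)) / n - ∫ ω, Y ω ∂μ|} ≤
      ENNReal.ofReal (2 * Real.exp (n * (c - l * ρ))) := by
  set m := ∫ ω, Y ω ∂μ
  have hZ : Measurable fun ω => Y ω - m := hY.sub_const m
  have hZb : ∀ᵐ ω ∂μ, Y ω - m ∈ Set.Icc (0 - m) (b - m) := by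
    filter_upwards [hb] with ω hω
    exact ⟨by linarith [hω.1], by linarith [hω.2]⟩
  have hZb' : ∀ᵐ ω ∂μ, -(Y ω - m) ∈ Set.Icc (-(b - m)) (-(0 - m)) := by
    filter_upwards [hb] with ω hω
    exact ⟨by linarith [hω.2], by linarith [hω.1]⟩
  have g1 := pi_sum_ge_le hZ hl (integrable_exp_mul_of_mem_Icc hZ.aemeasurable hZb) h1 n ρ
  have g2 := pi_sum_ge_le hZ.neg hl (integrable_exp_mul_of_mem_Icc hZ.neg.aemeasurable hZb')
    (by rw [mgf_neg]; exact h2) n ρ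
  have hn' : (0 : ℝ) < n := Nat.cast_pos.2 hn
  have hsub : {D : Fin n → Ω | ρ ≤ |(∑ i, Y (D i)) / n - m|} ⊆
      {D | n * ρ ≤ ∑ i, (Y (D i) - m)} ∪ {D | n * ρ ≤ ∑ i, (-fun ω => Y ω - m) (D i)} := by
    intro D hD
    have e : (∑ i, Y (D i)) / n - m = (∑ i, (Y (D i) - m)) / n := by
      rw [Finset.sum_sub_distrib]
      field_simp
      simp
    simp only [Set.mem_ofPred_eq, e, le_abs] at hD
    rcases hD with hD | hD
    · left
      rw [le_div_iff₀ hn'] at hD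
      simpa [mul_comm] using hD
    · right
      rw [← neg_div, le_div_iff₀ hn'] at hD
      rw [Set.mem_ofPred_eq]
      simp only [Pi.neg_apply, Finset.sum_neg_distrib]
      linarith
  calc _ ≤ _ := measure_mono hsub
    _ ≤ _ := measure_union_le _ _
    _ ≤ _ := add_le_add g1 g2
    _ = _ := by rw [← ENNReal.ofReal_add (by positivity) (by positivity)]; ring_nf

/-- Hoeffding's inequality for the mean of a sample. -/
theorem pi_mean_deviation_le_hoeffding {Y : Ω → ℝ} (hY : Measurable Y)
    (hb : ∀ᵐ ω ∂μ, Y ω ∈ Set.Icc (0 : ℝ) 1) {n : ℕ} (hn : 0 < n) {ρ : ℝ} (hρ : 0 ≤ ρ) :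
    (Measure.pi fun _ : Fin n => μ) {D | ρ ≤ |(∑ i, Y (D i)) / n - ∫ ω, Y ω ∂μ|} ≤
      ENNReal.ofReal (2 * Real.exp (-(2 * n * ρ ^ 2))) := by
  have hs := hasSubgaussianMGF_of_mem_Icc hY.aemeasurable hb
  -- The choice `l = 4 ρ` minimizes `l ^ 2 / 8 - l * ρ`, the exponent from Hoeffding's lemma. Fixing
  -- only `t ^ 2` covers both signs.
  have h1 : ∀ t : ℝ, t ^ 2 = (4 * ρ) ^ 2 →
      mgf (fun ω => Y ω - ∫ ω, Y ω ∂μ) μ t ≤ Real.exp (2 * ρ ^ 2) := by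
    intro t ht
    refine (hs.mgf_le t).trans_eq ?_
    rw [ht]
    congr 1
    simp
    ring
  have := pi_mean_deviation_le hY hb (by positivity : 0 ≤ 4 * ρ) (h1 _ rfl) (h1 _ (by ring)) hn ρ
  convert this using 4
  ring

/-- Combines `exp u ≤ 1 + u + u ^ 2` for `|u| ≤ 1` with `Y ^ 2 ≤ b * Y`, so that the variance is at
most `b` rather than of order `b ^ 2`. This keeps the training sets linear in `K`. -/
theorem mgf_le_of_mem_Icc {Y : Ω → ℝ} (hY : Measurable Y) {b : ℝ} (hb1 : 1 ≤ b)
    (hb : ∀ᵐ ω ∂μ, Y ω ∈ Set.Icc 0 b) (hm : ∫ ω, Y ω ∂μ ≤ 1) {t : ℝ} (ht : |t| * b ≤ 1) :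
    mgf (fun ω => Y ω - ∫ ω, Y ω ∂μ) μ t ≤ Real.exp (t ^ 2 * b) := by
  set m := ∫ ω, Y ω ∂μ with hmdef
  have hYi : Integrable Y μ := Integrable.of_mem_Icc 0 b hY.aemeasurable hb
  have hm0 : 0 ≤ m := integral_nonneg_of_ae (hb.mono fun _ h => h.1)
  have hle : ∀ᵐ ω ∂μ, Real.exp (t * (Y ω - m)) ≤
      1 + t * (Y ω - m) + t ^ 2 * ((b - 2 * m) * Y ω + m ^ 2) := by
    filter_upwards [hb] with ω hω
    have h1 : |Y ω - m| ≤ b := abs_le.2 ⟨by linarith [hω.1], by linarith [hω.2]⟩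
    have h2 : |t * (Y ω - m)| ≤ 1 := by
      rw [abs_mul]
      exact (mul_le_mul_of_nonneg_left h1 (abs_nonneg t)).trans ht
    have h3 := (abs_le.1 (Real.abs_exp_sub_one_sub_id_le h2)).2
    have h4 : (Y ω - m) ^ 2 ≤ (b - 2 * m) * Y ω + m ^ 2 := by
      nlinarith [mul_nonneg hω.1 (sub_nonneg.2 hω.2)]
    have h5 := mul_le_mul_of_nonneg_left h4 (sq_nonneg t)
    nlinarith
  have hi1 : Integrable (fun ω => 1 + t * (Y ω - m)) μ :=
    (integrable_const _).add ((hYi.sub (integrable_const _)).const_mul _)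
  have hi2 : Integrable (fun ω => t ^ 2 * ((b - 2 * m) * Y ω + m ^ 2)) μ :=
    ((hYi.const_mul _).add (integrable_const _)).const_mul _
  calc mgf (fun ω => Y ω - m) μ t
      ≤ ∫ ω, (1 + t * (Y ω - m) + t ^ 2 * ((b - 2 * m) * Y ω + m ^ 2)) ∂μ := by
        refine integral_mono_ae (integrable_exp_mul_of_mem_Icc (a := 0 - m) (b := b - m)
          (hY.sub_const m).aemeasurable ?_) (hi1.add hi2) hle
        filter_upwards [hb] with ω hω
        exact ⟨by linarith [hω.1], by linarith [hω.2]⟩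
    _ = 1 + t ^ 2 * ((b - 2 * m) * m + m ^ 2) := by
        have e : ∀ ω, 1 + t * (Y ω - m) + t ^ 2 * ((b - 2 * m) * Y ω + m ^ 2) =
            (1 - t * m + t ^ 2 * m ^ 2) + (t + t ^ 2 * (b - 2 * m)) * Y ω := fun ω => by ring
        simp_rw [e]
        rw [integral_add (integrable_const _) (hYi.const_mul _), integral_const_mul, ← hmdef]
        simp
        ring
    _ ≤ 1 + t ^ 2 * b := by
        have : (b - 2 * m) * m + m ^ 2 ≤ b := by nlinarith
        linarith [mul_le_mul_of_nonneg_left this (sq_nonneg t)]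
    _ ≤ _ := by linarith [Real.add_one_le_exp (t ^ 2 * b)]

/-- Bernstein's inequality for the mean of a sample of a variable with values in `[0, b]` and
mean at most `1`. -/
theorem pi_mean_deviation_le_bernstein {Y : Ω → ℝ} (hY : Measurable Y) {b : ℝ} (hb1 : 1 ≤ b)
    (hb : ∀ᵐ ω ∂μ, Y ω ∈ Set.Icc 0 b) (hm : ∫ ω, Y ω ∂μ ≤ 1) {n : ℕ} (hn : 0 < n) {ρ : ℝ}
    (hρ : 0 ≤ ρ) (hρ1 : ρ ≤ 1) :
    (Measure.pi fun _ : Fin n => μ) {D | ρ ≤ |(∑ i, Y (D i)) / n - ∫ ω, Y ω ∂μ|} ≤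
      ENNReal.ofReal (2 * Real.exp (-(n * ρ ^ 2 / (4 * b)))) := by
  have hb0 : 0 < b := by linarith
  -- The choice `l = ρ / (2 * b)` minimizes `l ^ 2 * b - l * ρ`, with value `-ρ ^ 2 / (4 * b)`; `ρ ≤
  -- 1` keeps it in the admissible range.
  have ht : |ρ / (2 * b)| * b ≤ 1 := by
    rw [abs_of_nonneg (by positivity)]
    field_simp
    linarith
  have h1 := mgf_le_of_mem_Icc hY hb1 hb hm ht
  have h2 := mgf_le_of_mem_Icc hY hb1 hb hm (t := -(ρ / (2 * b))) (by rwa [abs_neg])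
  rw [neg_sq] at h2
  have := pi_mean_deviation_le hY hb (by positivity : 0 ≤ ρ / (2 * b)) h1 h2 hn ρ
  convert this using 4
  field_simp
  ring

end Concentration

/-! ### Union bound over finitely many empirical means -/

section DataSets

variable {X A : Type*} [MeasurableSpace X] [MeasurableSpace A] {H : ℕ}

theorem measurable_empMean {n : ℕ} {f : Trajectory X A H → ℝ} (hf : Measurable f) :
    Measurable fun D : Fin n → Trajectory X A H => empMean D f :=
  (Finset.measurable_sum _ fun i _ => hf.comp (measurable_pi_apply i)).div_const _

/-- The empirical means of finitely many functions are simultaneously accurate. -/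
theorem exists_accurate_event {μ : Measure (Trajectory X A H)} {n : ℕ} {ρ : ℝ}
    (s : Finset (Trajectory X A H → ℝ)) (hs : ∀ f ∈ s, Measurable f) {c : ℝ≥0∞}
    (hc : ∀ f ∈ s, (Measure.pi fun _ : Fin n => μ) {D | ρ ≤ |empMean D f - ∫ τ, f τ ∂μ|} ≤ c) :
    ∃ E, MeasurableSet E ∧ (Measure.pi fun _ : Fin n => μ) Eᶜ ≤ s.card * c ∧
      ∀ D ∈ E, ∀ f ∈ s, |empMean D f - ∫ τ, f τ ∂μ| ≤ ρ := by
  have hm : MeasurableSet (⋃ f ∈ s, {D : Fin n → Trajectory X A H |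
      ρ ≤ |empMean D f - ∫ τ, f τ ∂μ|}) :=
    Finset.measurableSet_biUnion _ fun f hf =>
      measurableSet_le measurable_const ((measurable_empMean (hs f hf)).sub_const _).abs
  refine ⟨_, hm.compl, ?_, fun D hD f hf => ?_⟩
  · rw [compl_compl]
    refine (measure_biUnion_finset_le _ _).trans ((Finset.sum_le_sum hc).trans ?_)
    simp
  · simp only [Set.mem_compl_iff, Set.mem_iUnion, Set.mem_ofPred_eq, not_exists, not_le] at hD
    exact (hD f hf).le

end DataSets

/-! ### A program logic with failure probabilities -/

section Ensures

variable {X A : Type*} [MeasurableSpace X] [MeasurableSpace A] {H : ℕ}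
  [Fintype A] [Nonempty A] [MeasurableSingletonClass A] {S α β ι σ : Type*}

namespace Prog

/-- Outside of an event of probability at most `η` for each data set that is collected, the program
returns some `a` such that `Q a m N` holds for the final number `m` of data sets and the final
number `N` of episodes. -/
def Ensures (P : RichProcess S X A H) (η : ℝ≥0∞) (Q : α → ℕ → ℕ → Prop) :
    Prog X A H α → ℕ → ℕ → Prop
  | ret a, m, N => Q a m N
  | diverge, _, _ => False
  | collect n q k, m, N => ∃ E : Set (Fin n → Trajectory X A H), MeasurableSet E ∧
      (Measure.pi fun _ : Fin n => P.queryLaw q) Eᶜ ≤ η ∧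
        ∀ D ∈ E, Ensures P η Q (k D) (m + 1) (N + n)

variable {P : RichProcess S X A H} {η : ℝ≥0∞}

theorem Ensures.mono {Q Q' : α → ℕ → ℕ → Prop} {c : Prog X A H α} {m N : ℕ}
    (h : c.Ensures P η Q m N) (hQ : ∀ a m N, Q a m N → Q' a m N) : c.Ensures P η Q' m N := by
  induction c generalizing m N with
  | ret a => exact hQ _ _ _ h
  | diverge => exact h
  | collect n q k ih =>
    obtain ⟨E, hE, hE', h⟩ := h
    exact ⟨E, hE, hE', fun D hD => ih D (h D hD)⟩

/-- Since `η` is a budget per data set, composition adds no failure terms; the total is settled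
once, in `Ensures.le_prob`. -/
theorem Ensures.bind {Q : α → ℕ → ℕ → Prop} {Q' : β → ℕ → ℕ → Prop} {c : Prog X A H α}
    {f : α → Prog X A H β} {m N : ℕ} (h : c.Ensures P η Q m N)
    (hf : ∀ a m N, Q a m N → (f a).Ensures P η Q' m N) : (c.bind f).Ensures P η Q' m N := by
  induction c generalizing m N with
  | ret a => exact hf _ _ _ h
  | diverge => exact h
  | collect n q k ih =>
    obtain ⟨E, hE, hE', h⟩ := h
    exact ⟨E, hE, hE', fun D hD => ih D (h D hD)⟩

/-- The rule for loops, with an invariant that depends on the remaining items. -/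
theorem Ensures.forEach {f : ι → σ → Prog X A H σ} (I : List ι → σ → ℕ → ℕ → Prop)
    (hI : ∀ i l st m N, I (i :: l) st m N → (f i st).Ensures P η (I l) m N) (l : List ι) {st : σ}
    {m N : ℕ} (h : I l st m N) : (Prog.forEach l f st).Ensures P η (I []) m N := by
  induction l generalizing st m N with
  | nil => exact h
  | cons i l ih => exact (hI i l st m N h).bind fun st m N h => ih h

/-- Because `η < 1`, good events are nonempty, so some good run reaches a return; the counter never
decreases along it. -/
theorem Ensures.le_of_forall {Q : α → ℕ → ℕ → Prop} {c : Prog X A H α} {m N B : ℕ} (hη : η < 1)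
    (h : c.Ensures P η Q m N) (hQ : ∀ a m N, Q a m N → m ≤ B) : m ≤ B := by
  induction c generalizing m N with
  | ret a => exact hQ _ _ _ h
  | diverge => exact h.elim
  | collect n q k ih =>
    obtain ⟨E, hE, hE', h⟩ := h
    obtain ⟨D, hD⟩ : E.Nonempty := by
      rw [Set.nonempty_iff_ne_empty]
      rintro rfl
      rw [Set.compl_empty, measure_univ] at hE'
      exact absurd hE' (not_le.2 hη)
    have := ih D (h D hD)
    omega

/-- A union bound by induction over the program. The integrand in `prob` may fail to be measurable,
but restriction to the measurable event `E` still bounds its lower integral from below. -/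
theorem Ensures.le_prob {Q : α → ℕ → ℕ → Prop} {c : Prog X A H α} {m N B : ℕ} (hη : η < 1)
    (h : c.Ensures P η Q m N) (hB : ∀ a m N, Q a m N → m ≤ B) {Good : α → ℕ → Prop}
    (hQ : ∀ a m N, Q a m N → Good a N) : 1 - ((B - m : ℕ) : ℝ≥0∞) * η ≤ prob P Good c N := by
  induction c generalizing m N with
  | ret a =>
    rw [prob, if_pos (hQ _ _ _ h)]
    exact tsub_le_self
  | diverge => exact h.elim
  | collect n q k ih =>
    have hmB : m + 1 ≤ B := by
      obtain ⟨E, hE, hE', h⟩ := h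
      obtain ⟨D, hD⟩ : E.Nonempty := by
        rw [Set.nonempty_iff_ne_empty]
        rintro rfl
        rw [Set.compl_empty, measure_univ] at hE'
        exact absurd hE' (not_le.2 hη)
      exact (h D hD).le_of_forall hη hB
    obtain ⟨E, hE, hE', h⟩ := h
    set μ := Measure.pi fun _ : Fin n => P.queryLaw q
    set x : ℝ≥0∞ := 1 - ((B - (m + 1) : ℕ) : ℝ≥0∞) * η
    have h1 : x * μ E ≤ ∫⁻ D, prob P Good (k D) (N + n) ∂μ := by
      rw [← setLIntegral_const]
      exact (setLIntegral_mono' hE fun D hD => ih D (h D hD)).trans (setLIntegral_le_lintegral _ _)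
    -- Discarding the complement of `E` costs at most `x * η`, and `x ≤ 1`.
    have h2 : x ≤ x * μ E + η := by
      have : (1 : ℝ≥0∞) ≤ μ E + η := by
        rw [← measure_univ (μ := μ), ← measure_add_measure_compl hE]
        gcongr
      calc x = x * 1 := (mul_one x).symm
        _ ≤ x * (μ E + η) := by gcongr
        _ = x * μ E + x * η := mul_add _ _ _
        _ ≤ _ := by
          gcongr
          exact mul_le_of_le_one_left (zero_le) tsub_le_self
    refine le_trans ?_ h1
    refine le_trans ?_ (tsub_le_iff_right.2 h2)
    rw [tsub_tsub]
    refine tsub_le_tsub_left (le_of_eq ?_) 1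
    rw [show B - m = (B - (m + 1)) + 1 by omega]
    push_cast
    ring

end Prog

end Ensures

/-! ### Tests and training -/

section Subroutines

variable {S X A : Type*} [MeasurableSpace X] [MeasurableSpace A] {H : ℕ}
  [Fintype A] [Nonempty A] [MeasurableSingletonClass A]

namespace RichProcess

variable {P : RichProcess S X A H}

/-- A greedy policy is at least as good as any other one. -/
theorem RegularAt.stateValue_update_le {t n : ℕ} {s : S} (h : P.RegularAt (n + 1) t s)
    (hn : H = t + (n + 1)) (hl : (P.level s : ℕ) = t) (π : ℕ → Policy X A) (π' π'' : Policy X A)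
    (hπ' : ∀ x, (P.level (P.decode x) : ℕ) = t → ∀ a, P.qValue π x a ≤ P.qValue π x (π'.1 x)) :
    P.stateValue (Function.update π t π'') t s ≤ P.stateValue (Function.update π t π') t s := by
  have hae := h.ae_obsValue hn hl
  have hi : ∀ ρ : ℕ → Policy X A, Integrable (fun x => P.meanReward x ((ρ t).1 x) +
      P.expReturn ρ n (t + 1) (P.next s ((ρ t).1 x))) (P.emit s) := by
    intro ρ
    refine Integrable.of_mem_Icc 0 2 (measurable_bellman ρ n t s).aemeasurable ?_
    filter_upwards [hae] with x hx
    rw [← (hx ρ).1]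
    exact (hx ρ).2
  rw [stateValue_eq_expReturn _ hn, stateValue_eq_expReturn _ hn, h.expReturn_succ,
    h.expReturn_succ]
  refine integral_mono_ae (hi _) (hi _) ?_
  filter_upwards [ae_qValue_eq hn hl] with x hx
  have h3 : ∀ (ρ : Policy X A) a, P.expReturn (Function.update π t ρ) n (t + 1) (P.next s a) =
      P.expReturn π n (t + 1) (P.next s a) := fun ρ a =>
    expReturn_congr _ _ _ fun t' ht' => Function.update_of_ne (by omega) _ _
  have h2 := hπ' x hx.1 (π''.1 x)
  rw [hx.2, hx.2] at h2
  simpa only [h3, Function.update_self] using h2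

theorem stateValue_last (π : ℕ → Policy X A) {t : ℕ} (ht : H ≤ t) (s : S) :
    P.stateValue π t s = 0 := by
  have : P.stateValue π t s = P.expReturn π (H - t) t s := rfl
  rw [this, show H - t = 0 by omega]
  simp [expReturn, totalReturn]

/-- By how much `π` falls short of the optimal value at the hidden state of level `h` to which the
path `p` leads. -/
def gap (P : RichProcess S X A H) (π : ℕ → Policy X A) (h : ℕ) (p : List A) : ℝ :=
  P.optState (P.stateOf p) - P.stateValue π h (P.stateOf p)

theorem gap_congr {π π' : ℕ → Policy X A} {h : ℕ} (p : List A)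
    (e : ∀ t, h ≤ t → π t = π' t) : P.gap π h p = P.gap π' h p := by
  rw [gap, gap, stateValue_congr h _ e]

end RichProcess

open RichProcess

/-- The test data set `D` is accurate for the path `p` and the policy `π`. -/
def TestAccurate (P : RichProcess S X A H) (prm : Params) (G : Finset (X → ℝ))
    (π : ℕ → Policy X A) (h : Fin H) (p : List A) (D : Fin prm.nTest → Trajectory X A H) : Prop :=
  (∀ g ∈ G, |empMean D (fun τ => g (obs h τ)) - ∫ x, g x ∂(P.emit (P.stateOf p))| ≤ prm.τval) ∧
    |empMean D (retFrom h) - P.stateValue π h (P.stateOf p)| ≤ prm.τval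

/-- The training data set `D` is accurate for the path `p` and the policy `π`. -/
def TrainAccurate (P : RichProcess S X A H) (prm : Params) (Pi : Finset (Policy X A))
    (π : ℕ → Policy X A) (h : Fin H) (p : List A) (D : Fin prm.nTrain → Trajectory X A H) : Prop :=
  ∀ π' ∈ Pi, |ipsValue h D π' - P.stateValue (Function.update π h π') h (P.stateOf p)| ≤
    prm.τpol / 2

/-- What the analysis of the algorithm requires: the assumptions on the process, and that the data
sets are large enough to be accurate with probability at least `1 - η`. -/
structure Setup (P : RichProcess S X A H) (prm : Params) (Pi : Finset (Policy X A))
    (G : Finset (X → ℝ))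
    (fit : GState X A → (h : Fin H) → List (Fin prm.nTrain → Trajectory X A H) → Policy X A)
    (η : ℝ≥0∞) : Prop where
  regular : P.RegularRewards
  valueClass : ∀ g ∈ G, Measurable g ∧ ∀ x, g x ∈ Set.Icc (0 : ℝ) 1
  complete : P.PolicyComplete Pi
  realizable : P.ValueRealizable G
  fitRule : IsFitRule prm Pi fit
  tauval_nonneg : 0 ≤ prm.τval
  phi_last : ∀ t, t < H → 3 * prm.τpol ≤ prm.φ t
  phi_succ : ∀ t, t + 1 < H → prm.φ (t + 1) + 8 * prm.τval + 3 * prm.τpol ≤ prm.φ t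
  test : ∀ (π : ℕ → Policy X A) (h : Fin H) (p : List A), p.length = h →
    ∃ E, MeasurableSet E ∧ (Measure.pi fun _ : Fin prm.nTest => P.queryLaw ⟨p, false, π⟩) Eᶜ ≤ η ∧
      ∀ D ∈ E, TestAccurate P prm G π h p D
  train : ∀ (π : ℕ → Policy X A) (h : Fin H) (p : List A), p.length = h →
    ∃ E, MeasurableSet E ∧ (Measure.pi fun _ : Fin prm.nTrain => P.queryLaw ⟨p, true, π⟩) Eᶜ ≤ η ∧
      ∀ D ∈ E, TrainAccurate P prm Pi π h p D

theorem empMean_sub {n : ℕ} (D : Fin n → Trajectory X A H) (f g : Trajectory X A H → ℝ) :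
    empMean D (fun τ => f τ - g τ) = empMean D f - empMean D g := by
  simp [empMean, Finset.sum_sub_distrib, sub_div]

variable {P : RichProcess S X A H} {prm : Params} {Pi : Finset (Policy X A)} {G : Finset (X → ℝ)}
  {π : ℕ → Policy X A} {h : Fin H} {p q : List A}

/-- For feasible `g` the means on `D` and `D'` differ by at most `2 τval`, so its mean on `D` is at
most `Ê_{D'}[r̄] + φ h + 4 τval`. Nothing is needed about the quality of `π`. By contraposition, a
failed test certifies different hidden states. -/
theorem sameState_of_stateOf_eq {D D' : Fin prm.nTest → Trajectory X A H}
    (hD : TestAccurate P prm G π h p D) (hD' : TestAccurate P prm G π h q D')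
    (e : P.stateOf q = P.stateOf p) : SameState prm G h D D' := by
  rw [TestAccurate, e] at hD'
  have h1 := abs_le.1 hD.2
  have h2 := abs_le.1 hD'.2
  refine ⟨?_, by linarith [h1.1, h2.2]⟩
  refine Finset.sup_le fun g hg => ?_
  rw [Finset.mem_filter, empMean_sub] at hg
  have h3 := abs_le.1 (hD.1 g hg.1)
  have h4 := abs_le.1 (hD'.1 g hg.1)
  rw [WithBot.coe_le_coe]
  linarith [hg.2, h3.2, h4.1]

/-- The gap at `q` makes `g⋆` feasible, so `Ê_D[g⋆] ≤ vOpt`. The two parts of the test then give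
`Ê_D[g⋆] ≤ Ê_D[r̄] + φ h + 6 τval`, and passing to expectations on both sides costs `2 τval` more.
-/
theorem gap_le_of_sameState (hr : P.ValueRealizable G) {D D' : Fin prm.nTest → Trajectory X A H}
    (hD : TestAccurate P prm G π h p D) (hD' : TestAccurate P prm G π h q D')
    (hq : P.gap π h q ≤ prm.φ h) (hs : SameState prm G h D D') :
    P.gap π h p ≤ prm.φ h + 8 * prm.τval := by
  have h1 := abs_le.1 hD.2
  have h2 := abs_le.1 hD'.2
  have h3 := abs_le.1 (hD.1 _ hr)
  have h4 := abs_le.1 (hD'.1 _ hr)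
  rw [← optState] at h3 h4
  rw [gap] at hq ⊢
  have h5 : ((empMean D fun τ => P.optValueFun (obs h τ) : ℝ) : WithBot ℝ) ≤ vOpt prm G h D D' := by
    refine Finset.le_sup (f := fun g : X → ℝ => ((empMean D fun τ => g (obs h τ) : ℝ) : WithBot ℝ))
      (Finset.mem_filter.2 ⟨hr, ?_⟩)
    rw [empMean_sub]
    linarith [h4.2, h2.1]
  have h6 := h5.trans hs.1
  rw [WithBot.coe_le_coe] at h6
  linarith [hs.2, h1.2, h3.1]

variable {η : ℝ≥0∞}
  {fit : GState X A → (h : Fin H) → List (Fin prm.nTrain → Trajectory X A H) → Policy X A}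

open Prog

/-- Success transfers the guarantee of one learned path; failure certifies a state different from
all learned ones. That success forces `l ≠ []` is needed to show that the root is learned, not
pruned. -/
theorem Setup.testAgainst (hS : Setup P prm Pi G fit η) {D : Fin prm.nTest → Trajectory X A H}
    (hD : TestAccurate P prm G π h p D) (l : List (List A))
    (hl : ∀ q ∈ l, q.length = h ∧ P.gap π h q ≤ prm.φ h) (m N : ℕ) :
    (testAgainst prm G π h D l).Ensures P η (fun b m' N' =>
      (b = true → P.gap π h p ≤ prm.φ h + 8 * prm.τval ∧ l ≠ []) ∧
      (b = false → ∀ q ∈ l, P.stateOf q ≠ P.stateOf p) ∧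
      m' ≤ m + l.length ∧ N' ≤ N + l.length * prm.nTest) m N := by
  induction l generalizing m N with
  | nil => simp [GlobalPolicy.testAgainst, Ensures]
  | cons q l ih =>
    obtain ⟨E, hE, hE', hacc⟩ := hS.test π h q (hl q (by simp)).1
    refine ⟨E, hE, hE', fun D' hD' => ?_⟩
    beta_reduce
    split_ifs with hs
    · refine ⟨fun _ => ⟨gap_le_of_sameState hS.realizable hD (hacc D' hD') (hl q (by simp)).2 hs,
        by simp⟩, by simp, by simp, ?_⟩
      simp only [List.length_cons, add_mul]
      omega
    · refine (ih (fun q hq => hl q (by simp [hq])) (m + 1) (N + prm.nTest)).mono ?_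
      rintro b m' N' ⟨h1, h2, h3, h4⟩
      refine ⟨fun hb => ⟨(h1 hb).1, by simp⟩, fun hb q' hq' => ?_, ?_, ?_⟩
      · rcases List.mem_cons.1 hq' with rfl | hq'
        · exact fun e => hs (sameState_of_stateOf_eq hD (hacc D' hD') e)
        · exact h2 hb q' hq'
      · simp only [List.length_cons]; omega
      · simp only [List.length_cons, add_mul]; omega

theorem Setup.testLearned (hS : Setup P prm Pi G fit η) (st : GState X A) (hp : p.length = h)
    (hl : ∀ q ∈ st.learned h, q.length = h ∧ P.gap st.pol h q ≤ prm.φ h) (m N : ℕ) :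
    (testLearned prm G st h p).Ensures P η (fun b m' N' =>
      (b = true → P.gap st.pol h p ≤ prm.φ h + 8 * prm.τval ∧ st.learned h ≠ []) ∧
      (b = false → ∀ q ∈ st.learned h, P.stateOf q ≠ P.stateOf p) ∧
      m' ≤ m + ((st.learned h).length + 1) ∧
      N' ≤ N + ((st.learned h).length + 1) * prm.nTest) m N := by
  obtain ⟨E, hE, hE', hacc⟩ := hS.test st.pol h p hp
  refine ⟨E, hE, hE', fun D hD => ?_⟩
  refine (hS.testAgainst (hacc D hD) _ hl (m + 1) (N + prm.nTest)).mono ?_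
  rintro b m' N' ⟨h1, h2, h3, h4⟩
  refine ⟨h1, h2, by omega, ?_⟩
  rw [add_mul]
  omega

/-- Both directions of the matching matter: every data set belongs to a path, so that a fitting
policy exists, and every path has a data set, so that fitting controls its gap. -/
theorem Setup.collectTrain (hS : Setup P prm Pi G fit η) (l : List (List A))
    (hl : ∀ q ∈ l, q.length = h) (m N : ℕ) :
    (collectTrain prm.nTrain π l : Prog X A H _).Ensures P η (fun Ds m' N' =>
      (∀ q ∈ l, ∃ D ∈ Ds, TrainAccurate P prm Pi π h q D) ∧
      (∀ D ∈ Ds, ∃ q ∈ l, TrainAccurate P prm Pi π h q D) ∧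
      m' ≤ m + l.length ∧ N' ≤ N + l.length * prm.nTrain) m N := by
  induction l generalizing m N with
  | nil => simp [GlobalPolicy.collectTrain, Ensures]
  | cons q l ih =>
    obtain ⟨E, hE, hE', hacc⟩ := hS.train π h q (hl q (by simp))
    refine ⟨E, hE, hE', fun D hD => ?_⟩
    refine (ih (fun q hq => hl q (by simp [hq])) (m + 1) (N + prm.nTrain)).bind ?_
    rintro Ds m' N' ⟨h1, h2, h3, h4⟩
    refine ⟨fun q' hq' => ?_, fun D' hD' => ?_, ?_, ?_⟩
    · rcases List.mem_cons.1 hq' with rfl | hq'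
      · exact ⟨D, by simp, hacc D hD⟩
      · obtain ⟨D', hD', h⟩ := h1 q' hq'
        exact ⟨D', by simp [hD'], h⟩
    · rcases List.mem_cons.1 hD' with rfl | hD'
      · exact ⟨q, by simp, hacc _ hD⟩
      · obtain ⟨q', hq', h⟩ := h2 D' hD'
        exact ⟨q', by simp [hq'], h⟩
    · simp only [List.length_cons]; omega
    · simp only [List.length_cons, add_mul]; omega

/-- Training on accurate data sets yields a policy that is good on all paths concerned. -/
theorem Setup.gap_fit_le (hS : Setup P prm Pi G fit η) (st : GState X A) (h : Fin H)
    (hpol : ∀ t, st.pol t ∈ Pi) (l : List (List A)) (hl : ∀ q ∈ l, q.length = h)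
    {Ds : List (Fin prm.nTrain → Trajectory X A H)}
    (h1 : ∀ q ∈ l, ∃ D ∈ Ds, TrainAccurate P prm Pi st.pol h q D)
    (h2 : ∀ D ∈ Ds, ∃ q ∈ l, TrainAccurate P prm Pi st.pol h q D)
    (hc : (h : ℕ) + 1 < H → ∀ q ∈ l, ∀ a,
      P.gap st.pol (h + 1) (q ++ [a]) ≤ prm.φ (h + 1) + 8 * prm.τval)
    (q : List A) (hq : q ∈ l) :
    P.gap (Function.update st.pol h (fit st h Ds)) h q ≤ prm.φ h := by
  obtain ⟨π', hπ', hopt⟩ := hS.complete h st.pol fun h' _ => hpol h'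
  have hopt' : ∀ x, (P.level (P.decode x) : ℕ) = h → ∀ a,
      P.qValue st.pol x a ≤ P.qValue st.pol x (π'.1 x) := fun x hx => hopt x (Fin.ext hx)
  have hn : H = h + ((H - h - 1) + 1) := by omega
  have hreg : ∀ q ∈ l, P.RegularAt (H - h - 1 + 1) h (P.stateOf q) ∧
      (P.level (P.stateOf q) : ℕ) = h := fun q hq =>
    ⟨hl q hq ▸ hS.regular.regularAt q _ (by rw [hl q hq]; exact hn),
      by rw [level_stateOf q (by rw [hl q hq]; exact h.2), hl q hq]⟩
  have hle : ∀ (D : Fin prm.nTrain → Trajectory X A H) (π₁ : Policy X A), π₁ ∈ Pi → ipsValue h D π₁ ≤ ⨆ π₂ : Pi, ipsValue h D π₂.1 :=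
    fun D π₁ hπ₁ => le_ciSup (f := fun π₂ : Pi => ipsValue h D π₂.1)
      (Set.finite_range _).bddAbove ⟨π₁, hπ₁⟩
  -- A greedy policy maximizes the true value on every path, so two errors of `τpol / 2` leave it
  -- within the tolerance. Hence the rule is really bound to choose a fitting policy.
  have hfits : Fits prm Pi h Ds π' := by
    intro D hD
    obtain ⟨q, hq, hacc⟩ := h2 D hD
    have : Nonempty Pi := ⟨⟨π', hπ'⟩⟩
    rw [sub_le_iff_le_add]
    refine ciSup_le fun π₁ => ?_
    have e1 := abs_le.1 (hacc π₁.1 π₁.2)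
    have e2 := abs_le.1 (hacc π' hπ')
    have e3 := (hreg q hq).1.stateValue_update_le hn (hreg q hq).2 st.pol π' π₁.1 hopt'
    have e4 : 0 ≤ prm.τpol := by linarith [e2.1.trans e2.2]
    linarith [e1.2, e2.1]
  obtain ⟨hfit, hfit'⟩ := hS.fitRule st h Ds
  obtain ⟨D, hD, hacc⟩ := h1 q hq
  have e1 := abs_le.1 (hacc _ hfit)
  have e2 := abs_le.1 (hacc _ hπ')
  have e3 := hfit' ⟨π', hπ', hfits⟩ D hD
  have e4 := hle D π' hπ'
  have hgm := hS.valueClass _ hS.realizable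
  -- The loss `B` covers the gap at the successors; at the last level there is none and `B ≥ 0`
  -- suffices. The remaining `3 τpol` is the slack `2 τpol` of the rule plus two estimation errors.
  have e5 := (hreg q hq).1.optState_le_of_greedy hn (hreg q hq).2 hgm.1 hgm.2 st.pol π' hopt'
    (B := prm.φ h - 3 * prm.τpol) (fun a π'' => by
      by_cases hH : (h : ℕ) + 1 < H
      · have f1 := hc hH q hq a
        have f2 := hS.phi_succ h hH
        have hlen : (q ++ [a]).length = h + 1 := by simp [hl q hq]
        have f3 := hS.regular.regularAt (q ++ [a]) (H - h - 1 - 1 + 1) (by omega)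
        rw [hlen, stateOf_append_singleton] at f3
        have f4 := level_stateOf (P := P) (q ++ [a]) (by omega)
        rw [hlen, stateOf_append_singleton] at f4
        have f5 := f3.stateValue_le_optState (by omega) f4 hgm.1 hgm.2 π''
        rw [gap, stateOf_append_singleton] at f1
        linarith
      · rw [stateValue_last _ (by omega), stateValue_last _ (by omega)]
        linarith [hS.phi_last h h.2])
  rw [gap]
  linarith [e1.2, e2.1]

end Subroutines

/-! ### Counting hidden states, invariants and cost accounting -/

section Search

variable {S X A : Type*} [MeasurableSpace X] [MeasurableSpace A] {H : ℕ}
  [Fintype A] [Nonempty A] [MeasurableSingletonClass A]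

open RichProcess Prog

/-- Distinct hidden states at one level are at most `numStates` many. -/
theorem length_le_numStates [Finite S] (P : RichProcess S X A H) {t : ℕ} (ht : t < H)
    (l : List (List A)) (hl : ∀ q ∈ l, q.length = t) (hd : (l.map P.stateOf).Nodup) :
    l.length ≤ P.numStates := by
  classical
  have h1 : ∀ s ∈ l.map P.stateOf, P.level s = ⟨t, ht⟩ := by
    intro s hs
    obtain ⟨q, hq, rfl⟩ := List.mem_map.1 hs
    exact Fin.ext ((level_stateOf q (by rw [hl q hq]; exact ht)).trans (hl q hq))
  have h2 : l.length = (l.map P.stateOf).toFinset.card := by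
    rw [List.toFinset_card_of_nodup hd, List.length_map]
  have h3 : (l.map P.stateOf).toFinset.card ≤ Nat.card {s : S // P.level s = ⟨t, ht⟩} := by
    rw [← Nat.card_eq_fintype_card.trans (Fintype.card_coe (l.map P.stateOf).toFinset)]
    exact Nat.card_le_card_of_injective
      (fun s : (l.map P.stateOf).toFinset =>
        (⟨s.1, h1 s.1 (List.mem_toFinset.1 s.2)⟩ : {s : S // P.level s = ⟨t, ht⟩}))
      (fun a b e => Subtype.ext (congrArg (fun z : {s : S // P.level s = ⟨t, ht⟩} => z.1) e))
  rw [h2]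
  exact h3.trans (Finset.le_sup (f := fun h : Fin H => Nat.card {s : S // P.level s = h})
    (Finset.mem_univ _))

/-! ### Invariants -/

/-- The paths in the global variables have the right lengths, learned paths of a level lead to
different hidden states, and the policies belong to the class. -/
structure WellFormed (P : RichProcess S X A H) (Pi : Finset (Policy X A)) (st : GState X A) :
    Prop where
  pol_mem : ∀ t, st.pol t ∈ Pi
  learned_length : ∀ t, ∀ q ∈ st.learned t, q.length = t
  pruned_length : ∀ t, ∀ q ∈ st.pruned t, q.length = t
  nodup : ∀ t, ((st.learned t).map P.stateOf).Nodup

/-- The successors of the learned paths of level `t` have been dealt with. -/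
structure ClosedAt (H : ℕ) (st : GState X A) (t : ℕ) : Prop where
  children : t + 1 < H → ∀ q ∈ st.learned t, ∀ a,
    q ++ [a] ∈ st.learned (t + 1) ∨ q ++ [a] ∈ st.pruned (t + 1)
  card_pruned : (st.pruned (t + 1)).length ≤ Fintype.card A * (st.learned t).length

/-- The current policy is good on the learned paths of level `t`. -/
def LearnedGood (P : RichProcess S X A H) (prm : Params) (st : GState X A) (t : ℕ) : Prop :=
  ∀ q ∈ st.learned t, P.gap st.pol t q ≤ prm.φ t

/-- The current policy is good on the pruned paths of level `t`. -/
def PrunedGood (P : RichProcess S X A H) (prm : Params) (st : GState X A) (t : ℕ) : Prop :=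
  ∀ q ∈ st.pruned t, P.gap st.pol t q ≤ prm.φ t + 8 * prm.τval

/-- All is well from level `h` on. -/
def GoodFrom (P : RichProcess S X A H) (prm : Params) (st : GState X A) (h : ℕ) : Prop :=
  ∀ t, h ≤ t → t < H → ClosedAt H st t ∧ LearnedGood P prm st t ∧ PrunedGood P prm st t

/-- No path gets lost, and levels before `h` are not touched. -/
structure Extends (h : ℕ) (st st' : GState X A) : Prop where
  suffix : ∀ t, st.learned t <:+ st'.learned t
  kept : ∀ t, ∀ q ∈ st.pruned t, q ∈ st'.learned t ∨ q ∈ st'.pruned t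
  learned_eq : ∀ t, t < h → st'.learned t = st.learned t
  pruned_eq : ∀ t, t < h → st'.pruned t = st.pruned t

theorem Extends.refl (h : ℕ) (st : GState X A) : Extends h st st :=
  ⟨fun _ => List.suffix_rfl, fun _ _ hq => Or.inr hq, fun _ _ => rfl, fun _ _ => rfl⟩

theorem Extends.trans {h : ℕ} {st st' st'' : GState X A} (h1 : Extends h st st')
    (h2 : Extends h st' st'') : Extends h st st'' where
  suffix t := (h1.suffix t).trans (h2.suffix t)
  kept t q hq := (h1.kept t q hq).elim (fun hl => Or.inl ((h2.suffix t).subset hl)) (h2.kept t q)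
  learned_eq t ht := (h2.learned_eq t ht).trans (h1.learned_eq t ht)
  pruned_eq t ht := (h2.pruned_eq t ht).trans (h1.pruned_eq t ht)

theorem Extends.of_le {h h' : ℕ} {st st' : GState X A} (hh : h' ≤ h) (h1 : Extends h st st') :
    Extends h' st st' :=
  ⟨h1.suffix, h1.kept, fun t ht => h1.learned_eq t (by omega),
    fun t ht => h1.pruned_eq t (by omega)⟩

theorem Extends.mem {h : ℕ} {st st' : GState X A} (h1 : Extends h st st') {t : ℕ} {q : List A}
    (hq : q ∈ st.learned t ∨ q ∈ st.pruned t) : q ∈ st'.learned t ∨ q ∈ st'.pruned t :=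
  hq.elim (fun hl => Or.inl ((h1.suffix t).subset hl)) (h1.kept t q)

theorem ClosedAt.congr {st st' : GState X A} {t : ℕ} (h : ClosedAt H st t)
    (h0 : st'.learned t = st.learned t) (h1 : st'.learned (t + 1) = st.learned (t + 1))
    (h2 : st'.pruned (t + 1) = st.pruned (t + 1)) : ClosedAt H st' t :=
  ⟨by rw [h0, h1, h2]; exact h.children, by rw [h0, h2]; exact h.card_pruned⟩

/-- What holds from level `h` on depends only on lists and policies from level `h` on, so changes at
earlier levels are harmless. -/
theorem GoodFrom.congr {P : RichProcess S X A H} {prm : Params} {st st' : GState X A} {h : ℕ}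
    (hg : GoodFrom P prm st h) (h1 : ∀ t, h ≤ t → st'.learned t = st.learned t)
    (h2 : ∀ t, h ≤ t → st'.pruned t = st.pruned t) (h3 : ∀ t, h ≤ t → st'.pol t = st.pol t) :
    GoodFrom P prm st' h := by
  intro t ht htH
  obtain ⟨a, b, c⟩ := hg t ht htH
  refine ⟨a.congr (h1 t ht) (h1 _ (by omega)) (h2 _ (by omega)), fun q hq => ?_, fun q hq => ?_⟩
  · rw [h1 t ht] at hq
    rw [gap_congr q fun t' ht' => h3 t' (by omega)]
    exact b q hq
  · rw [h2 t ht] at hq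
    rw [gap_congr q fun t' ht' => h3 t' (by omega)]
    exact c q hq

theorem GoodFrom.of_le {P : RichProcess S X A H} {prm : Params} {st : GState X A} {h h' : ℕ}
    (hg : GoodFrom P prm st h) (hh : h ≤ h') : GoodFrom P prm st h' :=
  fun t ht => hg t (hh.trans ht)

/-- The total number of learned paths. -/
def numLearned (H : ℕ) (st : GState X A) : ℕ := ∑ t ∈ Finset.range H, (st.learned t).length

/-! ### Costs -/

/-- The cost of `u` tests and `v` rounds of training. -/
def Spent (M nTest nTrain u v m N m' N' : ℕ) : Prop :=
  m' ≤ m + (u * (M + 1) + v * M) ∧ N' ≤ N + (u * ((M + 1) * nTest) + v * (M * nTrain))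

/-- The cost of `d` tests and of what goes with learning some paths. -/
def Cost (M K nTest nTrain d L m N L' m' N' : ℕ) : Prop :=
  ∃ v, L' = L + v ∧ Spent M nTest nTrain (d + (K + K * M) * v) v m N m' N'

variable {M K a b : ℕ}

theorem Spent.trans {u v m N u' v' m' N' m'' N'' : ℕ} (h : Spent M a b u v m N m' N')
    (h' : Spent M a b u' v' m' N' m'' N'') : Spent M a b (u + u') (v + v') m N m'' N'' := by
  obtain ⟨h1, h2⟩ := h
  obtain ⟨h3, h4⟩ := h'
  constructor <;> nlinarith

theorem Cost.refl (L m N : ℕ) : Cost M K a b 0 L m N L m N :=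
  ⟨0, rfl, by simp [Spent]⟩

theorem Cost.trans {d L m N d' L' m' N' L'' m'' N'' : ℕ} (h : Cost M K a b d L m N L' m' N')
    (h' : Cost M K a b d' L' m' N' L'' m'' N'') :
    Cost M K a b (d + d') L m N L'' m'' N'' := by
  obtain ⟨v, rfl, h⟩ := h
  obtain ⟨v', rfl, h'⟩ := h'
  refine ⟨v + v', by ring, ?_⟩
  have := h.trans h'
  rwa [show d + (K + K * M) * v + (d' + (K + K * M) * v') =
    d + d' + (K + K * M) * (v + v') by ring] at this

theorem Cost.mono {d d' L m N L' m' N' : ℕ} (h : Cost M K a b d L m N L' m' N') (hd : d ≤ d') :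
    Cost M K a b d' L m N L' m' N' := by
  obtain ⟨v, hv, h1, h2⟩ := h
  refine ⟨v, hv, h1.trans ?_, h2.trans ?_⟩ <;> gcongr

theorem Cost.test {L m N m' N' l : ℕ} (hl : l ≤ M) (hm : m' ≤ m + (l + 1))
    (hN : N' ≤ N + (l + 1) * a) : Cost M K a b 1 L m N L m' N' := by
  refine ⟨0, rfl, by omega, hN.trans ?_⟩
  simp only [mul_zero, add_zero, one_mul, zero_mul]
  gcongr

/-- Children, training and re-checks are paid for by the path that has been learned. -/
theorem Cost.learn {L m N L' m' N' m'' N'' L₃ m₃ N₃ d : ℕ} (h1 : Cost M K a b K L m N L' m' N')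
    (hm : m'' ≤ m' + M) (hN : N'' ≤ N' + M * b) (hd : d ≤ K * M)
    (h2 : Cost M K a b d (L' + 1) m'' N'' L₃ m₃ N₃) : Cost M K a b 0 L m N L₃ m₃ N₃ := by
  obtain ⟨v, rfl, h1⟩ := h1
  replace h2 := h2.mono hd
  obtain ⟨v', rfl, h2⟩ := h2
  refine ⟨v + 1 + v', by ring, ?_⟩
  -- The middle summand is the round of training for the newly learned path.
  have := (h1.trans (u' := 0) (v' := 1) (m'' := m'') (N'' := N'') ⟨by omega, by omega⟩).trans h2
  rwa [show K + (K + K * M) * v + 0 + (K * M + (K + K * M) * v') =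
    0 + (K + K * M) * (v + 1 + v') by ring] at this

end Search

/-! ### Depth-first search: contract and loops -/

section DepthFirst

variable {S X A : Type*} [MeasurableSpace X] [MeasurableSpace A] {H : ℕ}
  [Fintype A] [Nonempty A] [MeasurableSingletonClass A]

open RichProcess Prog

open Classical in
/-- The part of `dfslearn` after the initial test, for an arbitrary procedure `rec` in place of the
recursive calls. -/
def dfsBody (prm : Params) (G : Finset (X → ℝ))
    (fit : GState X A → (h : Fin H) → List (Fin prm.nTrain → Trajectory X A H) → Policy X A)
    (rec : Bool → List A → GState X A → Prog X A H (GState X A)) (h : Fin H) (p : List A)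
    (st : GState X A) : Prog X A H (GState X A) :=
  (Prog.forEach (Finset.univ : Finset A).toList
    (fun a st => rec false (p ++ [a]) st) st).bind fun st₁ =>
  let st₂ : GState X A :=
    { st₁ with learned := Function.update st₁.learned h (p :: st₁.learned h) }
  (collectTrain prm.nTrain st₂.pol (st₂.learned h)).bind fun Ds =>
  let st₃ : GState X A := { st₂ with pol := Function.update st₂.pol h (fit st₂ h Ds) }
  Prog.forEach (st₃.pruned h)
    (fun q st =>
      if q ∈ st.pruned h then
        (testLearned prm G st h q).bind fun same =>
        if same then .ret st
        else rec true q
          { st with pruned :=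
              Function.update st.pruned h ((st.pruned h).filter fun q' => q' ≠ q) }
      else .ret st) st₃

theorem dfslearn_succ (prm : Params) (Pi : Finset (Policy X A)) (G : Finset (X → ℝ))
    (fit : GState X A → (h : Fin H) → List (Fin prm.nTrain → Trajectory X A H) → Policy X A)
    (fuel : ℕ) (recheck : Bool) (p : List A) (st : GState X A) :
    dfslearn prm Pi G fit (fuel + 1) recheck p st =
      if hp : p.length < H then
        (if recheck then .ret false else testLearned prm G st ⟨p.length, hp⟩ p).bind fun same =>
        if same then
          .ret { st with pruned :=
            Function.update st.pruned p.length (p :: st.pruned p.length) }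
        else dfsBody prm G fit (dfslearn prm Pi G fit fuel) ⟨p.length, hp⟩ p st
      else .ret st := by
  rw [dfslearn]
  rfl

/-- What a call of `dfslearn` requires. -/
structure DfsPre (P : RichProcess S X A H) (prm : Params) (Pi : Finset (Policy X A)) (fuel : ℕ)
    (recheck : Bool) (p : List A) (st : GState X A) : Prop where
  wf : WellFormed P Pi st
  good : GoodFrom P prm st (p.length + 1)
  closed : p.length < H → ClosedAt H st p.length
  -- A re-check call skips the initial test, and it arises while pruned paths of its level are still
  -- pending; it cannot ask for this.
  prunedGood : recheck = false → p.length < H →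
    LearnedGood P prm st p.length ∧ PrunedGood P prm st p.length
  isNew : recheck = true → ∀ q ∈ st.learned p.length, P.stateOf q ≠ P.stateOf p
  card_pruned : p.length < H → (st.pruned p.length).length ≤ Fintype.card A * P.numStates
  fuel_pos : 1 ≤ fuel
  -- Each recursive call either descends a level, lowering the left side by `M + 1`, or stays at its
  -- level after a path has been learned there. Both make up for the unit of fuel spent.
  fuel_le : p.length < H →
    (H - p.length) * (P.numStates + 1) + 1 ≤ fuel + (st.learned p.length).length

/-- What a call of `dfslearn` achieves, with `d` tests in addition to those that are paid for by
learned paths. -/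
structure DfsPost (P : RichProcess S X A H) (prm : Params) (Pi : Finset (Policy X A)) (d : ℕ)
    (p : List A) (st : GState X A) (m N : ℕ) (st' : GState X A) (m' N' : ℕ) : Prop where
  wf : WellFormed P Pi st'
  good : GoodFrom P prm st' p.length
  extend : Extends p.length st st'
  mem : p.length < H → p ∈ st'.learned p.length ∨ p ∈ st'.pruned p.length
  -- Needed for the root: a pruned path has the weaker guarantee `φ + 8 τval`, which would overshoot
  -- `ε`.
  learned_ne_nil : p.length < H → st'.learned p.length ≠ []
  card_pruned : (st'.pruned p.length).length ≤ (st.pruned p.length).length + d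
  cost : Cost P.numStates (Fintype.card A) prm.nTest prm.nTrain d
    (numLearned H st) m N (numLearned H st') m' N'

variable [Finite S] {P : RichProcess S X A H} {prm : Params} {Pi : Finset (Policy X A)}
  {G : Finset (X → ℝ)} {η : ℝ≥0∞}
  {fit : GState X A → (h : Fin H) → List (Fin prm.nTrain → Trajectory X A H) → Policy X A}

theorem WellFormed.length_learned_le {st : GState X A} (h : WellFormed P Pi st) {t : ℕ}
    (ht : t < H) : (st.learned t).length ≤ P.numStates :=
  length_le_numStates P ht _ (h.learned_length t) (h.nodup t)

theorem WellFormed.nodup_cons {st : GState X A} (hw : WellFormed P Pi st) {h : ℕ} {p : List A}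
    (hnew : ∀ q ∈ st.learned h, P.stateOf q ≠ P.stateOf p) :
    ((p :: st.learned h).map P.stateOf).Nodup := by
  rw [List.map_cons, List.nodup_cons]
  refine ⟨fun hm => ?_, hw.nodup h⟩
  obtain ⟨q, hq, e⟩ := List.mem_map.1 hm
  exact hnew q hq e

/-- A path to a new state leaves room among the `M` states. This is what caps the pruned paths of
the next level and leaves fuel for the successors. -/
theorem WellFormed.length_learned_lt {st : GState X A} (hw : WellFormed P Pi st) {h : ℕ}
    (hh : h < H) {p : List A} (hp : p.length = h)
    (hnew : ∀ q ∈ st.learned h, P.stateOf q ≠ P.stateOf p) :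
    (st.learned h).length + 1 ≤ P.numStates :=
  length_le_numStates P hh (p :: st.learned h)
    (List.forall_mem_cons.2 ⟨hp, hw.learned_length h⟩) (hw.nodup_cons hnew)

theorem numLearned_update {st : GState X A} {h : ℕ} (hh : h < H) (p : List A)
    (pol : ℕ → Policy X A) (pr : ℕ → List (List A)) :
    numLearned H ⟨Function.update st.learned h (p :: st.learned h), pr, pol⟩ =
      numLearned H st + 1 := by
  have e : ∀ t, (Function.update st.learned h (p :: st.learned h) t).length =
      (st.learned t).length + if t = h then 1 else 0 := by
    intro t
    by_cases ht : t = h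
    · subst ht; simp
    · simp [ht]
  unfold numLearned
  simp only [e, Finset.sum_add_distrib]
  simp [hh]

/-- The calls for the successors of a path. -/
theorem forEach_children (fuel : ℕ)
    (rec : Bool → List A → GState X A → Prog X A H (GState X A))
    (hrec : ∀ recheck p st m N, DfsPre P prm Pi fuel recheck p st →
      (rec recheck p st).Ensures P η
        (DfsPost P prm Pi (if recheck then 0 else 1) p st m N) m N)
    {h : ℕ} (hh : h < H) {p : List A} (hp : p.length = h) {st : GState X A}
    (hw : WellFormed P Pi st) (hg : GoodFrom P prm st (h + 1)) (hc : ClosedAt H st h)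
    (hnew : ∀ q ∈ st.learned h, P.stateOf q ≠ P.stateOf p)
    (hfuel : (H - h) * (P.numStates + 1) + 1 ≤ fuel + 1 + (st.learned h).length) (m N : ℕ) :
    (Prog.forEach (Finset.univ : Finset A).toList
      (fun a st => rec false (p ++ [a]) st) st).Ensures P η (fun st' m' N' =>
        WellFormed P Pi st' ∧ GoodFrom P prm st' (h + 1) ∧ Extends (h + 1) st st' ∧
        (h + 1 < H → ∀ a, p ++ [a] ∈ st'.learned (h + 1) ∨ p ++ [a] ∈ st'.pruned (h + 1)) ∧
        (st'.pruned (h + 1)).length ≤ Fintype.card A * ((st.learned h).length + 1) ∧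
        Cost P.numStates (Fintype.card A) prm.nTest prm.nTrain (Fintype.card A)
          (numLearned H st) m N (numLearned H st') m' N') m N := by
  have hlt := hw.length_learned_lt hh hp hnew
  -- Goodness at level `h` is absent from the invariant: successor calls may change later policies.
  -- Since `p` is not learned yet, pruned successors are counted separately, at most one for each
  -- item done.
  refine (Ensures.forEach (fun rest st' m' N' => ∃ done, done ++ rest = Finset.univ.toList ∧
    WellFormed P Pi st' ∧ GoodFrom P prm st' (h + 1) ∧ Extends (h + 1) st st' ∧
    (h + 1 < H → ∀ a ∈ done,
      p ++ [a] ∈ st'.learned (h + 1) ∨ p ++ [a] ∈ st'.pruned (h + 1)) ∧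
    (st'.pruned (h + 1)).length ≤ Fintype.card A * (st.learned h).length + done.length ∧
    Cost P.numStates (Fintype.card A) prm.nTest prm.nTrain done.length
      (numLearned H st) m N (numLearned H st') m' N') ?_ _
    ⟨[], rfl, hw, hg, Extends.refl _ _, by simp, by simpa using hc.card_pruned,
      Cost.refl _ _ _⟩).mono ?_
  · rintro a rest st' m' N' ⟨done, hd, hw', hg', he', hm', hcard', hcost'⟩
    have hlen : (p ++ [a]).length = h + 1 := by simp [hp]
    have hK : done.length + 1 + rest.length = Fintype.card A := by
      have := congrArg List.length hd
      simp at this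
      omega
    have hKM : Fintype.card A * (st.learned h).length + Fintype.card A ≤
        Fintype.card A * P.numStates := by
      rw [← Nat.mul_succ]
      exact Nat.mul_le_mul_left _ hlt
    have hsub : (H - h) * (P.numStates + 1) =
        (H - (h + 1)) * (P.numStates + 1) + (P.numStates + 1) := by
      rw [← Nat.succ_mul]; congr 1; omega
    have hpre : DfsPre P prm Pi fuel false (p ++ [a]) st' := by
      refine ⟨hw', ?_, ?_, ?_, by simp, ?_, by omega, ?_⟩ <;> rw [hlen]
      · exact hg'.of_le (by omega)
      · exact fun h1 => (hg' _ le_rfl h1).1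
      · exact fun _ h1 => (hg' _ le_rfl h1).2
      · exact fun _ => by omega
      · exact fun _ => by omega
    refine (hrec false (p ++ [a]) st' m' N' hpre).mono fun st'' m'' N'' hpost => ?_
    obtain ⟨hw'', hg'', he'', hm'', -, hcard'', hcost''⟩ := hpost
    rw [hlen] at hg'' he'' hm'' hcard''
    refine ⟨done ++ [a], by simp [hd], hw'', hg'', he'.trans he'', fun h1 a' ha' => ?_, ?_, ?_⟩
    · rcases List.mem_append.1 ha' with ha' | ha'
      · exact he''.mem (hm' h1 a' ha')
      · obtain rfl := List.mem_singleton.1 ha'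
        exact hm'' h1
    · simp at hcard'' ⊢
      omega
    · rw [List.length_append]
      exact hcost'.trans hcost''
  · rintro st' m' N' ⟨done, hd, hw', hg', he', hm', hcard', hcost'⟩
    rw [List.append_nil] at hd
    subst hd
    rw [Finset.length_toList, Finset.card_univ] at hcard' hcost'
    exact ⟨hw', hg', he', fun h1 a => hm' h1 a (by simp), by rw [mul_add]; omega, hcost'⟩

open Classical in
/-- The re-checks of the pruned paths. -/
theorem Setup.forEach_recheck (hS : Setup P prm Pi G fit η) (fuel : ℕ)
    (rec : Bool → List A → GState X A → Prog X A H (GState X A))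
    (hrec : ∀ recheck p st m N, DfsPre P prm Pi fuel recheck p st →
      (rec recheck p st).Ensures P η
        (DfsPost P prm Pi (if recheck then 0 else 1) p st m N) m N)
    (h : Fin H) {st : GState X A}
    (hw : WellFormed P Pi st) (hg : GoodFrom P prm st (h + 1)) (hc : ClosedAt H st h)
    (hl : LearnedGood P prm st h)
    (hcard : (st.pruned h).length ≤ Fintype.card A * P.numStates)
    (hfuel : (H - h) * (P.numStates + 1) + 1 ≤ fuel + (st.learned h).length) (m N : ℕ) :
    (Prog.forEach (st.pruned h)
      (fun q st =>
        if q ∈ st.pruned h then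
          (GlobalPolicy.testLearned prm G st h q).bind fun same =>
          if same then .ret st
          else rec true q
            { st with pruned :=
                Function.update st.pruned h ((st.pruned h).filter fun q' => q' ≠ q) }
        else .ret st) st).Ensures P η (fun st' m' N' =>
        WellFormed P Pi st' ∧ GoodFrom P prm st' h ∧ Extends h st st' ∧
        (st'.pruned h).length ≤ (st.pruned h).length ∧
        Cost P.numStates (Fintype.card A) prm.nTest prm.nTrain (st.pruned h).length
          (numLearned H st) m N (numLearned H st') m' N') m N := by
  -- Each pruned path is either pending or good for the current policy. A recursive call may retrain
  -- this level, but it returns with all pruned paths good, so pending items only get easier. The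
  -- number of finished items is `d`.
  refine (Ensures.forEach (fun rest st' m' N' => ∃ d, d + rest.length = (st.pruned h).length ∧
    WellFormed P Pi st' ∧ GoodFrom P prm st' (h + 1) ∧ ClosedAt H st' h ∧
    LearnedGood P prm st' h ∧
    (∀ q ∈ st'.pruned h, q ∈ rest ∨ P.gap st'.pol h q ≤ prm.φ h + 8 * prm.τval) ∧
    Extends h st st' ∧ (st'.pruned h).length ≤ (st.pruned h).length ∧
    Cost P.numStates (Fintype.card A) prm.nTest prm.nTrain d
      (numLearned H st) m N (numLearned H st') m' N') ?_ _
    ⟨0, by simp, hw, hg, hc, hl, fun q hq => Or.inl hq, Extends.refl _ _, le_rfl,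
      Cost.refl _ _ _⟩).mono ?_
  · rintro q rest st' m' N' ⟨d, hd, hw', hg', hc', hl', hp', he', hcard', hcost'⟩
    rw [List.length_cons] at hd
    have hMle := hw'.length_learned_le h.2
    split_ifs with hq
    · have hqlen := hw'.pruned_length h q hq
      refine (hS.testLearned st' hqlen
        (fun q hq => ⟨hw'.learned_length h q hq, hl' q hq⟩) m' N').bind ?_
      rintro same m'' N'' ⟨h1, h2, h3, h4⟩
      have hcost'' := hcost'.trans (Cost.test (K := Fintype.card A) (b := prm.nTrain)
        (L := numLearned H st') hMle h3 h4)
      cases same with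
      | true =>
        refine ⟨d + 1, by omega, hw', hg', hc', hl', fun q' hq' => ?_, he', hcard', hcost''⟩
        rcases hp' q' hq' with hq1 | hq1
        · rcases List.mem_cons.1 hq1 with rfl | hq1
          · exact Or.inr (h1 rfl).1
          · exact Or.inl hq1
        · exact Or.inr hq1
      | false =>
        simp only [Bool.false_eq_true, if_false]
        set st₁ : GState X A := ⟨st'.learned, Function.update st'.pruned h
          ((st'.pruned h).filter fun q' => q' ≠ q), st'.pol⟩ with hst₁
        have hpr : st₁.pruned h = (st'.pruned h).filter fun q' => q' ≠ q :=
          Function.update_self ..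
        have hpr' : ∀ t : ℕ, t ≠ h → st₁.pruned t = st'.pruned t := fun t ht =>
          Function.update_of_ne ht _ _
        have hlen1 : (st₁.pruned h).length ≤ (st'.pruned h).length := by
          rw [hpr]; exact List.length_filter_le _ _
        have hw1 : WellFormed P Pi st₁ := by
          refine ⟨hw'.pol_mem, hw'.learned_length, fun t q' hq' => ?_, hw'.nodup⟩
          by_cases ht : t = h
          · subst ht
            rw [hpr] at hq'
            exact hw'.pruned_length _ q' (List.mem_filter.1 hq').1
          · rw [hpr' t ht] at hq'
            exact hw'.pruned_length t q' hq'
        have hpre : DfsPre P prm Pi fuel true q st₁ := by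
          refine ⟨hw1, ?_, fun _ => ?_, by simp, fun _ => ?_, fun _ => ?_, ?_, fun _ => ?_⟩
          · rw [hqlen]
            exact hg'.congr (fun _ _ => rfl) (fun t ht => hpr' t (by omega)) (fun _ _ => rfl)
          · rw [hqlen]
            exact hc'.congr rfl rfl (hpr' _ (by omega))
          · rw [hqlen]
            exact h2 rfl
          · rw [hqlen]
            omega
          · have : 1 * (P.numStates + 1) ≤ (H - h) * (P.numStates + 1) :=
              Nat.mul_le_mul_right _ (by have := h.2; omega)
            have h5 := hw.length_learned_le h.2
            omega
          · rw [hqlen]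
            exact hfuel.trans (Nat.add_le_add_left (he'.suffix h).length_le _)
        refine (hrec true q st₁ m'' N'' hpre).mono fun st₂ m₂ N₂ hpost => ?_
        obtain ⟨hw2, hg2, he2, hm2, -, hcard2, hcost2⟩ := hpost
        rw [hqlen] at hg2 he2 hm2 hcard2
        obtain ⟨hc2, hl2, hp2⟩ := hg2 h le_rfl h.2
        refine ⟨d + 1, by omega, hw2, hg2.of_le (by omega), hc2, hl2,
          fun q' hq' => Or.inr (hp2 q' hq'), he'.trans ?_, ?_, ?_⟩
        -- The path removed before the call is the only one missing from `st₁`, and the call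
        -- restores it as learned or pruned.
        · refine ⟨he2.suffix, fun t q' hq' => ?_, he2.learned_eq, fun t ht => ?_⟩
          · by_cases ht : t = h
            · subst ht
              by_cases e : q' = q
              · subst e
                exact hm2 h.2
              · exact he2.kept _ q' (by rw [hpr]; exact List.mem_filter.2 ⟨hq', by simpa using e⟩)
            · exact he2.kept t q' (by rw [hpr' t ht]; exact hq')
          · rw [he2.pruned_eq t ht, hpr' t (by omega)]
        · simp at hcard2
          omega
        · exact hcost''.trans hcost2
    · refine ⟨d + 1, by omega, hw', hg', hc', hl', fun q' hq' => ?_, he', hcard',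
        hcost'.mono (by omega)⟩
      rcases hp' q' hq' with hq1 | hq1
      · rcases List.mem_cons.1 hq1 with rfl | hq1
        · exact absurd hq' hq
        · exact Or.inl hq1
      · exact Or.inr hq1
  · rintro st' m' N' ⟨d, hd, hw', hg', hc', hl', hp', he', hcard', hcost'⟩
    refine ⟨hw', fun t ht htH => ?_, he', hcard', hcost'.mono (by simp at hd; omega)⟩
    by_cases e : t = h
    · subst e
      exact ⟨hc', hl', fun q hq => (hp' q hq).resolve_left (by simp)⟩
    · exact hg' t (by omega) htH

end DepthFirst

/-! ### Correctness of the search and of the algorithm -/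

section DepthFirst

variable {S X A : Type*} [MeasurableSpace X] [MeasurableSpace A] {H : ℕ}
  [Fintype A] [Nonempty A] [MeasurableSingletonClass A]
  [Finite S] {P : RichProcess S X A H} {prm : Params} {Pi : Finset (Policy X A)}
  {G : Finset (X → ℝ)} {η : ℝ≥0∞}
  {fit : GState X A → (h : Fin H) → List (Fin prm.nTrain → Trajectory X A H) → Policy X A}

open RichProcess Prog

/-- The successor loop secures level `h + 1`, training makes all learned paths of level `h` good
again, and the re-checks do the same for its pruned paths. No test remains unpaid: all are charged
to learned paths, which gives the cost index `0`. -/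
theorem Setup.dfsBody (hS : Setup P prm Pi G fit η) (fuel : ℕ)
    (rec : Bool → List A → GState X A → Prog X A H (GState X A))
    (hrec : ∀ recheck p st m N, DfsPre P prm Pi fuel recheck p st →
      (rec recheck p st).Ensures P η
        (DfsPost P prm Pi (if recheck then 0 else 1) p st m N) m N)
    (h : Fin H) {p : List A} (hp : p.length = h) {st : GState X A}
    (hw : WellFormed P Pi st) (hg : GoodFrom P prm st (h + 1)) (hc : ClosedAt H st h)
    (hnew : ∀ q ∈ st.learned h, P.stateOf q ≠ P.stateOf p)
    (hcard : (st.pruned h).length ≤ Fintype.card A * P.numStates)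
    (hfuel : (H - h) * (P.numStates + 1) + 1 ≤ fuel + 1 + (st.learned h).length) (m N : ℕ) :
    (dfsBody prm G fit rec h p st).Ensures P η (DfsPost P prm Pi 0 p st m N) m N := by
  refine (forEach_children fuel rec hrec h.2 hp hw hg hc hnew hfuel m N).bind ?_
  rintro st₁ m₁ N₁ ⟨hw₁, hg₁, he₁, hm₁, hcard₁, hcost₁⟩
  have hl₁ : st₁.learned h = st.learned h := he₁.learned_eq h (Nat.lt_succ_self _)
  have hp₁ : st₁.pruned h = st.pruned h := he₁.pruned_eq h (Nat.lt_succ_self _)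
  have hnew₁ : ∀ q ∈ st₁.learned h, P.stateOf q ≠ P.stateOf p := by rw [hl₁]; exact hnew
  set st₂ : GState X A :=
    ⟨Function.update st₁.learned h (p :: st₁.learned h), st₁.pruned, st₁.pol⟩ with hst₂
  have hl₂ : st₂.learned h = p :: st₁.learned h := Function.update_self ..
  have hl₂' : ∀ t : ℕ, t ≠ h → st₂.learned t = st₁.learned t := fun t ht =>
    Function.update_of_ne ht _ _
  have hlen₂ : ∀ t, ∀ q ∈ st₂.learned t, q.length = t := by
    intro t q hq
    by_cases ht : t = h
    · subst ht
      rw [hl₂] at hq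
      rcases List.mem_cons.1 hq with rfl | hq
      exacts [hp, hw₁.learned_length h q hq]
    · rw [hl₂' t ht] at hq
      exact hw₁.learned_length t q hq
  refine (hS.collectTrain (π := st₂.pol) (st₂.learned h) (hlen₂ h) m₁ N₁).bind ?_
  rintro Ds m₂ N₂ ⟨hD₁, hD₂, hm₂, hN₂⟩
  have hchildren : (h : ℕ) + 1 < H → ∀ q ∈ st₂.learned h, ∀ a,
      q ++ [a] ∈ st₁.learned (h + 1) ∨ q ++ [a] ∈ st₁.pruned (h + 1) := by
    intro hH q hq a
    rw [hl₂] at hq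
    rcases List.mem_cons.1 hq with rfl | hq
    · exact hm₁ hH a
    · rw [hl₁] at hq
      exact he₁.mem (hc.children hH q hq a)
  have hgap := hS.gap_fit_le st₂ h hw₁.pol_mem _ (hlen₂ h) hD₁ hD₂ (fun hH q hq a => by
    obtain ⟨-, hl, hpr⟩ := hg₁ (h + 1) le_rfl hH
    rcases hchildren hH q hq a with h1 | h1
    · exact (hl _ h1).trans (by linarith [hS.tauval_nonneg])
    · exact hpr _ h1)
  set st₃ : GState X A :=
    ⟨st₂.learned, st₂.pruned, Function.update st₂.pol h (fit st₂ h Ds)⟩ with hst₃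
  have hpol₃ : ∀ t : ℕ, t ≠ h → st₃.pol t = st₁.pol t := fun t ht =>
    Function.update_of_ne ht _ _
  have hlen₁ := hw₁.length_learned_lt h.2 hp hnew₁
  have hw₃ : WellFormed P Pi st₃ := by
    refine ⟨fun t => ?_, hlen₂, hw₁.pruned_length, fun t => ?_⟩
    · by_cases ht : t = h
      · subst ht
        rw [show st₃.pol h = fit st₂ h Ds from Function.update_self ..]
        exact (hS.fitRule st₂ h Ds).1
      · rw [hpol₃ t ht]
        exact hw₁.pol_mem t
    · by_cases ht : t = h
      · subst ht
        change ((st₂.learned h).map P.stateOf).Nodup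
        rw [hl₂]
        exact hw₁.nodup_cons hnew₁
      · change ((st₂.learned t).map P.stateOf).Nodup
        rw [hl₂' t ht]
        exact hw₁.nodup t
  have hg₃ : GoodFrom P prm st₃ (h + 1) :=
    hg₁.congr (fun t ht => hl₂' t (by omega)) (fun _ _ => rfl) (fun t ht => hpol₃ t (by omega))
  have hc₃ : ClosedAt H st₃ h := by
    refine ⟨fun hH q hq a => ?_, ?_⟩
    · change q ++ [a] ∈ st₂.learned (h + 1) ∨ _
      rw [hl₂' _ (by omega)]
      exact hchildren hH q hq a
    · change (st₁.pruned (h + 1)).length ≤ _ * (st₂.learned h).length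
      rw [hl₂, List.length_cons, hl₁]
      exact hcard₁
  have hlenl₃ : (st₃.learned h).length = (st.learned h).length + 1 := by
    change (st₂.learned h).length = _
    rw [hl₂, List.length_cons, hl₁]
  refine (hS.forEach_recheck fuel rec hrec h hw₃ hg₃ hc₃ hgap
    (by change (st₁.pruned h).length ≤ _; rw [hp₁]; exact hcard) (by omega) m₂ N₂).mono ?_
  rintro st₄ m₄ N₄ ⟨hw₄, hg₄, he₄, hcard₄, hcost₄⟩
  have hpst₃ : st₃.pruned h = st.pruned h := hp₁
  have hpl : p ∈ st₄.learned h :=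
    (he₄.suffix h).subset (by change p ∈ st₂.learned h; rw [hl₂]; simp)
  refine ⟨hw₄, ?_, ?_, fun _ => ?_, fun _ => ?_, ?_, ?_⟩
  · rw [hp]; exact hg₄
  · rw [hp]
    have he₃ : Extends h st₁ st₃ := by
      refine ⟨fun t => ?_, fun t q hq => Or.inr hq, fun t ht => hl₂' t (by omega), fun _ _ => rfl⟩
      change _ <:+ st₂.learned t
      by_cases ht : t = h
      · subst ht
        rw [hl₂]
        exact List.suffix_cons _ _
      · rw [hl₂' t ht]
    exact (he₁.of_le (Nat.le_succ _)).trans (he₃.trans he₄)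
  · rw [hp]; exact Or.inl hpl
  · rw [hp]; exact List.ne_nil_of_mem hpl
  · rw [hp, ← hpst₃]; exact hcard₄
  · have hnl : numLearned H st₃ = numLearned H st₁ + 1 := numLearned_update h.2 p _ _
    rw [hnl] at hcost₄
    rw [hl₂, List.length_cons] at hm₂ hN₂
    -- The successor loop leaves the pruned list of level `h` alone, so the cap `K * M` on re-checks
    -- still applies.
    refine hcost₁.learn (hm₂.trans (by omega)) (hN₂.trans ?_) (by rw [hpst₃]; exact hcard) hcost₄
    exact Nat.add_le_add_left (Nat.mul_le_mul_right _ hlen₁) _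

/-- The specification of `dfslearn`. -/
theorem Setup.dfslearn (hS : Setup P prm Pi G fit η) (fuel : ℕ) :
    ∀ recheck p st m N, DfsPre P prm Pi fuel recheck p st →
      (dfslearn prm Pi G fit fuel recheck p st).Ensures P η
        (DfsPost P prm Pi (if recheck then 0 else 1) p st m N) m N := by
  induction fuel with
  | zero => intro _ _ _ _ _ h; exact absurd h.fuel_pos (by simp)
  | succ fuel ih =>
    intro recheck p st m N h
    rw [dfslearn_succ]
    by_cases hp : p.length < H
    swap
    · rw [dif_neg hp]
      exact ⟨h.wf, fun t ht htH => absurd htH (by omega), Extends.refl _ _, fun h' => absurd h' hp,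
        fun h' => absurd h' hp, by omega, (Cost.refl _ _ _).mono (by omega)⟩
    rw [dif_pos hp]
    split_ifs with hr
    · subst hr
      exact hS.dfsBody fuel _ ih ⟨p.length, hp⟩ rfl h.wf h.good (h.closed hp) (h.isNew rfl)
        (h.card_pruned hp) (h.fuel_le hp) m N
    · have hr' : recheck = false := by simpa using hr
      obtain ⟨hl, hpr⟩ := h.prunedGood hr' hp
      refine (hS.testLearned (h := ⟨p.length, hp⟩) st rfl
        (fun q hq => ⟨h.wf.learned_length _ q hq, hl q hq⟩) m N).bind ?_
      rintro same m' N' ⟨h1, h2, h3, h4⟩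
      have hcost := Cost.test (K := Fintype.card A) (b := prm.nTrain) (L := numLearned H st)
        (h.wf.length_learned_le hp) h3 h4
      cases same with
      | true =>
        obtain ⟨hgap, hne⟩ := h1 rfl
        simp only [if_true]
        set st' : GState X A := ⟨st.learned,
          Function.update st.pruned p.length (p :: st.pruned p.length), st.pol⟩ with hst'
        have e1 : st'.pruned p.length = p :: st.pruned p.length := Function.update_self ..
        have e2 : ∀ t : ℕ, t ≠ p.length → st'.pruned t = st.pruned t := fun t ht =>
          Function.update_of_ne ht _ _
        refine ⟨⟨h.wf.pol_mem, h.wf.learned_length, fun t q hq => ?_, h.wf.nodup⟩,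
          fun t ht htH => ?_,
          ⟨fun _ => List.suffix_rfl, fun t q hq => Or.inr ?_, fun _ _ => rfl,
            fun t ht => e2 t (by omega)⟩,
          fun _ => Or.inr (by rw [e1]; simp), fun _ => hne, by rw [e1]; simp, hcost⟩
        · by_cases ht : t = p.length
          · subst ht
            rw [e1] at hq
            rcases List.mem_cons.1 hq with rfl | hq
            exacts [rfl, h.wf.pruned_length _ q hq]
          · rw [e2 t ht] at hq
            exact h.wf.pruned_length t q hq
        · by_cases e : t = p.length
          · subst e
            refine ⟨(h.closed hp).congr rfl rfl (e2 _ (by omega)), hl, fun q hq => ?_⟩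
            rw [e1] at hq
            rcases List.mem_cons.1 hq with rfl | hq
            exacts [hgap, hpr q hq]
          · exact h.good.congr (st' := st') (fun _ _ => rfl) (fun t ht => e2 t (by omega))
              (fun _ _ => rfl) t (by omega) htH
        · by_cases e : t = p.length
          · subst e
            rw [e1]
            exact List.mem_cons_of_mem _ hq
          · rw [e2 t e]
            exact hq
      | false =>
        simp only [Bool.false_eq_true, if_false]
        refine (hS.dfsBody fuel _ ih ⟨p.length, hp⟩ rfl h.wf h.good (h.closed hp) (h2 rfl)
          (h.card_pruned hp) (h.fuel_le hp) m' N').mono fun st' m'' N'' hpost => ?_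
        obtain ⟨a, b, c, d, e, f, g⟩ := hpost
        refine ⟨a, b, c, d, e, by omega, ?_⟩
        exact hcost.trans g

/-- The specification of the algorithm. -/
theorem Setup.main (hS : Setup P prm Pi G fit η) {pol₀ : ℕ → Policy X A}
    (hpol₀ : ∀ t, pol₀ t ∈ Pi) :
    (GlobalPolicy.main prm Pi G fit pol₀ (H * (P.numStates + 1) + 1)).Ensures P η (fun π m N =>
      P.optValue - P.value π ≤ prm.φ 0 ∧ ∃ v, v ≤ H * P.numStates ∧
        Spent P.numStates prm.nTest prm.nTrain
          (1 + (Fintype.card A + Fintype.card A * P.numStates) * v) v 0 0 m N) 0 0 := by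
  have hH : 0 < H := (P.level P.start).pos
  set st₀ : GState X A := ⟨fun _ => [], fun _ => [], pol₀⟩
  have hpre : DfsPre P prm Pi (H * (P.numStates + 1) + 1) false [] st₀ := by
    have hcl : ∀ t, ClosedAt H st₀ t := fun t => ⟨by simp [st₀], by simp [st₀]⟩
    exact ⟨⟨hpol₀, by simp [st₀], by simp [st₀], by simp [st₀]⟩,
      fun t _ _ => ⟨hcl t, by simp [LearnedGood, st₀], by simp [PrunedGood, st₀]⟩,
      fun _ => hcl _, fun _ _ => ⟨by simp [LearnedGood, st₀], by simp [PrunedGood, st₀]⟩,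
      by simp, by simp [st₀], by omega, by simp [st₀]⟩
  refine (hS.dfslearn _ false [] st₀ 0 0 hpre).bind ?_
  rintro st m N ⟨hw, hg, -, -, hne, -, hcost⟩
  refine ⟨?_, ?_⟩
  -- Only the empty path has length zero, so a nonempty learned list at level `0` contains the root.
  · obtain ⟨q, hq⟩ := List.exists_mem_of_ne_nil _ (hne hH)
    have hq0 : q = [] := List.length_eq_zero_iff.1 (hw.learned_length _ q hq)
    subst hq0
    have h1 := (hg 0 le_rfl hH).2.1 [] hq
    have hgm := hS.valueClass _ hS.realizable
    have : Nonempty (ℕ → Policy X A) := ⟨pol₀⟩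
    have h2 : P.optValue ≤ P.optState P.start := ciSup_le fun π =>
      (hS.regular.regularAt [] (H - 1 + 1) (by simp; omega)).stateValue_le_optState
        (by simp; omega) P.level_start hgm.1 hgm.2 π
    have h3 : P.gap st.pol 0 [] = P.optState P.start - P.value st.pol := rfl
    linarith
  · obtain ⟨v, hv, hs⟩ := hcost
    refine ⟨v, ?_, hs⟩
    have h0 : numLearned H st₀ = 0 := by simp [numLearned, st₀]
    rw [h0, zero_add] at hv
    rw [← hv, numLearned]
    calc ∑ t ∈ Finset.range H, (st.learned t).length
        ≤ ∑ _t ∈ Finset.range H, P.numStates :=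
          Finset.sum_le_sum fun t ht => hw.length_learned_le (Finset.mem_range.1 ht)
      _ = _ := by simp

end DepthFirst

/-! ### Sample sizes that make data sets accurate -/

section SampleSizes

variable {S X A : Type*} [MeasurableSpace X] [MeasurableSpace A] {H : ℕ}
  [Fintype A] [Nonempty A] [MeasurableSingletonClass A]
  {P : RichProcess S X A H} {prm : Params} {Pi : Finset (Policy X A)}
  {G : Finset (X → ℝ)} {L τ : ℝ}

open RichProcess

/-- Hoeffding's bound for the `G.card` value functions and one more variable, the return; `nTest` is
chosen so that `2 * nTest * τ ^ 2 ≥ L`. -/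
theorem exists_testAccurate_event (hP : P.RegularRewards)
    (hG : ∀ g ∈ G, Measurable g ∧ ∀ x, g x ∈ Set.Icc (0 : ℝ) 1) (hτ : prm.τval = τ) (hτ0 : 0 < τ)
    (hL : 0 < L) (hn : L / (2 * τ ^ 2) ≤ prm.nTest) (π : ℕ → Policy X A) (h : Fin H) (p : List A)
    (hp : p.length = h) :
    ∃ E, MeasurableSet E ∧ (Measure.pi fun _ : Fin prm.nTest => P.queryLaw ⟨p, false, π⟩) Eᶜ ≤
      ENNReal.ofReal ((G.card + 1) * (2 * Real.exp (-L))) ∧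
      ∀ D ∈ E, TestAccurate P prm G π h p D := by
  classical
  have hn0 : 0 < prm.nTest := by
    have : (0 : ℝ) < prm.nTest := lt_of_lt_of_le (by positivity) hn
    exact_mod_cast this
  have hexp : Real.exp (-(2 * prm.nTest * τ ^ 2)) ≤ Real.exp (-L) := by
    rw [div_le_iff₀ (by positivity)] at hn
    exact Real.exp_le_exp.2 (by linarith)
  set s : Finset (Trajectory X A H → ℝ) :=
    insert (retFrom h) (G.image fun g τ => g (obs h τ)) with hs
  have hs' : ∀ f ∈ s, Measurable f ∧
      ∀ᵐ τ ∂(P.queryLaw ⟨p, false, π⟩), f τ ∈ Set.Icc (0 : ℝ) 1 := by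
    intro f hf
    rcases Finset.mem_insert.1 hf with rfl | hf
    · exact ⟨measurable_retFrom h, hP.ae_retFrom ⟨p, false, π⟩ h hp⟩
    · obtain ⟨g, hg, rfl⟩ := Finset.mem_image.1 hf
      exact ⟨(hG g hg).1.comp (measurable_obs h),
        Filter.Eventually.of_forall fun τ => (hG g hg).2 _⟩
  obtain ⟨E, hE, hE', hacc⟩ := exists_accurate_event (μ := P.queryLaw ⟨p, false, π⟩)
    (n := prm.nTest) (ρ := τ) s (fun f hf => (hs' f hf).1)
    (c := ENNReal.ofReal (2 * Real.exp (-L))) (fun f hf =>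
      (pi_mean_deviation_le_hoeffding (hs' f hf).1 (hs' f hf).2 hn0 hτ0.le).trans
        (ENNReal.ofReal_le_ofReal (by linarith)))
  refine ⟨E, hE, hE'.trans ?_, fun D hD => ⟨fun g hg => ?_, ?_⟩⟩
  · rw [ENNReal.ofReal_mul (p := (G.card : ℝ) + 1) (by positivity)]
    refine mul_le_mul_left ?_ _
    rw [← ENNReal.ofReal_natCast]
    refine ENNReal.ofReal_le_ofReal ?_
    have : s.card ≤ G.card + 1 := (Finset.card_insert_le _ _).trans
      (Nat.add_le_add_right Finset.card_image_le 1)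
    exact_mod_cast this
  · have := hacc D hD (fun τ => g (obs h τ))
      (Finset.mem_insert_of_mem (Finset.mem_image_of_mem (fun g τ => g (obs h τ)) hg))
    rw [integral_obs ⟨p, false, π⟩ h hp (hG g hg).1] at this
    rw [hτ]
    exact this
  · have := hacc D hD (retFrom h) (Finset.mem_insert_self _ _)
    rw [integral_retFrom p π h hp] at this
    rw [hτ]
    exact this

/-- Bernstein's bound with `b = K` and deviation `τ / 2` has exponent `n * τ ^ 2 / (16 * K)`, whence
the factor `16` in `nTrain`. Its mean hypothesis holds because the weighted return averages to a
value of a policy. -/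
theorem exists_trainAccurate_event (hP : P.RegularRewards) (hτ : prm.τpol = τ) (hτ0 : 0 < τ)
    (hτ1 : τ ≤ 1) (hL : 0 < L) (hn : 16 * Fintype.card A * L / τ ^ 2 ≤ prm.nTrain)
    (π : ℕ → Policy X A) (h : Fin H) (p : List A) (hp : p.length = h) :
    ∃ E, MeasurableSet E ∧ (Measure.pi fun _ : Fin prm.nTrain => P.queryLaw ⟨p, true, π⟩) Eᶜ ≤
      ENNReal.ofReal (Pi.card * (2 * Real.exp (-L))) ∧
      ∀ D ∈ E, TrainAccurate P prm Pi π h p D := by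
  classical
  have hK : (1 : ℝ) ≤ Fintype.card A := by exact_mod_cast Fintype.card_pos
  have hn0 : 0 < prm.nTrain := by
    have : (0 : ℝ) < prm.nTrain := lt_of_lt_of_le (by positivity) hn
    exact_mod_cast this
  have hexp : Real.exp (-(prm.nTrain * (τ / 2) ^ 2 / (4 * Fintype.card A))) ≤ Real.exp (-L) := by
    rw [div_le_iff₀ (by positivity)] at hn
    refine Real.exp_le_exp.2 (neg_le_neg ?_)
    rw [le_div_iff₀ (by positivity)]
    linarith
  have hint : ∀ π' : Policy X A, ∫ τ, ipsReturn h π' τ ∂(P.queryLaw ⟨p, true, π⟩) ≤ 1 := by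
    intro π'
    have hn' : H = p.length + (H - p.length) := by omega
    rw [hP.integral_ipsReturn p π h hp, ← hp, stateValue_eq_expReturn _ hn']
    exact ((hP.regularAt p _ hn').expReturn_mem_Icc _).2
  obtain ⟨E, hE, hE', hacc⟩ := exists_accurate_event (μ := P.queryLaw ⟨p, true, π⟩)
    (n := prm.nTrain) (ρ := τ / 2) (Pi.image (ipsReturn h)) (fun f hf => by
      obtain ⟨π', -, rfl⟩ := Finset.mem_image.1 hf
      exact measurable_ipsReturn h π')
    (c := ENNReal.ofReal (2 * Real.exp (-L))) (fun f hf => by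
      obtain ⟨π', -, rfl⟩ := Finset.mem_image.1 hf
      exact (pi_mean_deviation_le_bernstein (measurable_ipsReturn h π') hK
        (hP.ae_ipsReturn ⟨p, true, π⟩ h hp π') (hint π') hn0 (by positivity)
        (by linarith)).trans (ENNReal.ofReal_le_ofReal (by linarith)))
  refine ⟨E, hE, hE'.trans ?_, fun D hD π' hπ' => ?_⟩
  · rw [ENNReal.ofReal_mul (p := (Pi.card : ℝ)) (by positivity), ENNReal.ofReal_natCast]
    gcongr
    exact Finset.card_image_le
  · have := hacc D hD _ (Finset.mem_image_of_mem (ipsReturn h) hπ')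
    rw [hP.integral_ipsReturn p π h hp] at this
    rw [hτ]
    exact this

end SampleSizes

/-! ### Arithmetic -/

/-- The summand `1` is the test of the root; the others are paid for by the `v` learned paths. -/
theorem tests_le {M H K v : ℕ} (hM : 1 ≤ M) (hH : 1 ≤ H) (hK : 1 ≤ K) (hv : v ≤ H * M) :
    1 + (K + K * M) * v ≤ 3 * M ^ 2 * H * K := by
  have h1 : K + K * M ≤ 2 * (K * M) := by nlinarith
  have h2 : 1 ≤ M ^ 2 * H * K := Nat.one_le_iff_ne_zero.2 (by positivity)
  calc 1 + (K + K * M) * v ≤ M ^ 2 * H * K + 2 * (K * M) * (H * M) := by gcongr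
    _ = _ := by ring

/-- Each test uses at most `M + 1 ≤ 2 * M` data sets and each round of training at most `M`. The
factor `12`, where `7` would do, matches the choice of `η`. -/
theorem dataSets_le {M H K v a b u m N : ℕ} (hM : 1 ≤ M) (hH : 1 ≤ H) (hK : 1 ≤ K)
    (hv : v ≤ H * M) (hu : u = 1 + (K + K * M) * v) (hs : Spent M a b u v 0 0 m N) :
    m ≤ 12 * M ^ 3 * H * K ∧ N ≤ 6 * M ^ 3 * H * K * a + M ^ 2 * H * b := by
  have hu' : u ≤ 3 * M ^ 2 * H * K := hu ▸ tests_le hM hH hK hv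
  have hM2 : M + 1 ≤ 2 * M := by omega
  have h1 : u * (M + 1) ≤ 6 * M ^ 3 * H * K :=
    (Nat.mul_le_mul hu' hM2).trans_eq (by ring)
  have h2 : v * M ≤ M ^ 2 * H := (Nat.mul_le_mul_right M hv).trans_eq (by ring)
  have h3 : M ^ 2 * H ≤ M ^ 3 * H * K := by
    calc M ^ 2 * H = M ^ 2 * 1 * H * 1 := by ring
      _ ≤ M ^ 2 * M * H * K := by gcongr
      _ = _ := by ring
  obtain ⟨hm, hN⟩ := hs
  constructor
  · have : 6 * M ^ 3 * H * K + M ^ 3 * H * K ≤ 12 * M ^ 3 * H * K := by nlinarith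
    omega
  · rw [← mul_assoc, ← mul_assoc] at hN
    have := Nat.mul_le_mul_right a h1
    have := Nat.mul_le_mul_right b h2
    omega

/-- With all factors other than `M` collected in `z ≥ 1`, this is `48 * M ^ 3 * z ≤ (2 * M * z) ^
6`; six is the least exponent with `2 ^ k ≥ 48`. -/
theorem log_le_six_mul_log {M H K p g δ : ℝ} (hM : 1 ≤ M) (hH : 1 ≤ H) (hK : 1 ≤ K) (hp : 1 ≤ p)
    (hg : 1 ≤ g) (hδ : 0 < δ) (hδ1 : δ < 1) :
    Real.log (16 * (3 * M ^ 2 * H * K) * M * p * g / δ) ≤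
      6 * Real.log (2 * M * H * K * p * g / δ) := by
  have hd : 1 ≤ 1 / δ := by rw [le_div_iff₀ hδ]; linarith
  set z := H * K * p * g * (1 / δ) with hz
  have hz1 : 1 ≤ z :=
    one_le_mul_of_one_le_of_one_le (one_le_mul_of_one_le_of_one_le (one_le_mul_of_one_le_of_one_le
      (one_le_mul_of_one_le_of_one_le hH hK) hp) hg) hd
  have e1 : 16 * (3 * M ^ 2 * H * K) * M * p * g / δ = 48 * M ^ 3 * z := by rw [hz]; ring
  have e2 : 2 * M * H * K * p * g / δ = 2 * M * z := by rw [hz]; ring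
  rw [e1, e2, show (6 : ℝ) * Real.log (2 * M * z) = Real.log ((2 * M * z) ^ 6) by
    rw [Real.log_pow]; norm_num]
  refine Real.log_le_log (by positivity) ?_
  have h1 : M ^ 3 ≤ M ^ 6 := pow_le_pow_right₀ hM (by norm_num)
  have h2 : z ≤ z ^ 6 := le_self_pow₀ hz1 (by norm_num)
  calc 48 * M ^ 3 * z ≤ 64 * M ^ 6 * z ^ 6 := by gcongr; norm_num
    _ = _ := by ring

/-- As `w ≥ 1`, rounding up is absorbed: `a ≤ 2 * w` and `b ≤ 17 * K * w`. The constant is `(6 * 2 +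
17) * 11 ^ 2 = 3509`, with `11 ^ 2` from `τ`. -/
theorem trajectories_le {M H K L ε τ a b : ℝ} (hM : 1 ≤ M) (hH : 1 ≤ H) (hK : 1 ≤ K) (hL : 1 ≤ L)
    (hε : 0 < ε) (hε1 : ε < 1) (hτ : τ = ε / (11 * H)) (hb0 : 0 ≤ b) (ha : a ≤ L / (2 * τ ^ 2) + 1)
    (hb : b ≤ 16 * K * L / τ ^ 2 + 1) :
    6 * M ^ 3 * H * K * a + M ^ 2 * H * b ≤ 3509 * (M ^ 3 * H ^ 3 * K / ε ^ 2) * L := by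
  set w := L / τ ^ 2 with hw
  have hτ0 : 0 < τ := by rw [hτ]; positivity
  have hτ1 : τ ≤ 1 := by
    rw [hτ, div_le_one (by positivity)]
    linarith
  have hw1 : 1 ≤ w := by
    rw [hw, le_div_iff₀ (by positivity)]
    have : τ ^ 2 ≤ 1 := pow_le_one₀ hτ0.le hτ1
    linarith
  have ha' : a ≤ 2 * w := by
    have : L / (2 * τ ^ 2) = w / 2 := by rw [hw]; field_simp
    linarith
  have hb' : b ≤ 17 * K * w := by
    have : 16 * K * L / τ ^ 2 = 16 * K * w := by rw [hw]; ring
    have : 1 ≤ K * w := one_le_mul_of_one_le_of_one_le hK hw1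
    linarith
  have hM23 : M ^ 2 ≤ M ^ 3 := pow_le_pow_right₀ hM (by norm_num)
  calc 6 * M ^ 3 * H * K * a + M ^ 2 * H * b
      ≤ 6 * M ^ 3 * H * K * (2 * w) + M ^ 3 * H * (17 * K * w) := by
        gcongr
    _ = 29 * (M ^ 3 * H * K) * w := by ring
    _ = 3509 * (M ^ 3 * H ^ 3 * K / ε ^ 2) * L := by
        rw [hw, hτ]
        field_simp
        ring

theorem one_le_numStates {S X A : Type*} [Finite S] [MeasurableSpace X] [MeasurableSpace A] {H : ℕ}
    (P : RichProcess S X A H) : 1 ≤ P.numStates := by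
  have : Nonempty {s : S // P.level s = P.level P.start} := ⟨⟨P.start, rfl⟩⟩
  exact (Nat.one_le_iff_ne_zero.2 Nat.card_pos.ne').trans
    (Finset.le_sup (f := fun h : Fin H => Nat.card {s : S // P.level s = h})
      (Finset.mem_univ (P.level P.start)))

end GlobalPolicy

end

/-! ### Choice of constants and conclusion -/

theorem mainTheorem7 :
    ∃ C : ℝ, 0 < C ∧
      ∀ {S X A : Type*} [Finite S] [MeasurableSpace X]
        [Fintype A] [Nonempty A] [MeasurableSpace A] [MeasurableSingletonClass A]
        (H : ℕ) (P : GlobalPolicy.RichProcess S X A H), P.RegularRewards →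
      ∀ (Pi : Finset (GlobalPolicy.Policy X A)) (G : Finset (X → ℝ)),
        (∀ g ∈ G, Measurable g ∧ ∀ x, g x ∈ Set.Icc (0 : ℝ) 1) →
        P.PolicyComplete Pi → P.ValueRealizable G →
      ∀ ε ∈ Set.Ioo (0 : ℝ) 1, ∀ δ ∈ Set.Ioo (0 : ℝ) 1,
      ∀ prm : GlobalPolicy.Params,
        prm = GlobalPolicy.params P.numStates H (Fintype.card A) Pi.card G.card ε δ →
      ∀ fit : GlobalPolicy.GState X A → (h : Fin H) →
          List (Fin prm.nTrain → GlobalPolicy.Trajectory X A H) → GlobalPolicy.Policy X A,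
        GlobalPolicy.IsFitRule prm Pi fit →
      ∀ pol₀ : ℕ → GlobalPolicy.Policy X A, (∀ h, pol₀ h ∈ Pi) →
        ENNReal.ofReal (1 - δ) ≤
          GlobalPolicy.successProb P prm Pi G fit pol₀ fun π N =>
            P.optValue - P.value π ≤ ε ∧
            (N : ℝ) ≤ C * ((P.numStates : ℝ) ^ 3 * (H : ℝ) ^ 3 * Fintype.card A / ε ^ 2) *
              Real.log (2 * P.numStates * H * Fintype.card A * Pi.card * G.card / δ) := by
  -- This is `6 * 3509`: the factor from comparing the logarithms times the one from counting
  -- trajectories.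
  refine ⟨21054, by norm_num, ?_⟩
  intro S X A _ _ _ _ _ _ H P hP Pi G hG hcomp hreal ε hε δ hδ prm hprm fit hfit pol₀ hpol₀
  obtain ⟨hε0, hε1⟩ := hε
  obtain ⟨hδ0, hδ1⟩ := hδ
  have hH : 1 ≤ H := (P.level P.start).pos
  have hM := GlobalPolicy.one_le_numStates P
  have hK : 1 ≤ Fintype.card A := Fintype.card_pos
  have hNP : 1 ≤ Pi.card := Finset.card_pos.2 ⟨_, hpol₀ 0⟩
  have hNG : 1 ≤ G.card := Finset.card_pos.2 ⟨_, hreal⟩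
  have hHr : (1 : ℝ) ≤ H := by exact_mod_cast hH
  have hMr : (1 : ℝ) ≤ P.numStates := by exact_mod_cast hM
  have hKr : (1 : ℝ) ≤ Fintype.card A := by exact_mod_cast hK
  have hNPr : (1 : ℝ) ≤ Pi.card := by exact_mod_cast hNP
  have hNGr : (1 : ℝ) ≤ G.card := by exact_mod_cast hNG
  set τ : ℝ := ε / (11 * H) with hτ
  set L : ℝ := Real.log (16 * (3 * (P.numStates : ℝ) ^ 2 * H * Fintype.card A) * P.numStates *
    Pi.card * G.card / δ) with hLdef
  have hτ0 : 0 < τ := by positivity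
  have hτ1 : τ ≤ 1 := by rw [hτ, div_le_one (by positivity)]; linarith
  have hexpL : Real.exp (-L) = δ / (48 * (P.numStates : ℝ) ^ 3 * H * Fintype.card A *
      Pi.card * G.card) := by
    rw [Real.exp_neg, hLdef, Real.exp_log (by positivity), inv_div]
    congr 1
    ring
  have hL1 : 1 ≤ L := by
    have h1 : 48 * (P.numStates : ℝ) ^ 3 * H * Fintype.card A * Pi.card * G.card ≥ 48 := by
      have : (1 : ℝ) ≤ (P.numStates : ℝ) ^ 3 * H * Fintype.card A * Pi.card * G.card :=
        one_le_mul_of_one_le_of_one_le (one_le_mul_of_one_le_of_one_le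
          (one_le_mul_of_one_le_of_one_le (one_le_mul_of_one_le_of_one_le
            (one_le_pow₀ hMr) hHr) hKr) hNPr) hNGr
      linarith
    have h2 : Real.exp (-L) ≤ Real.exp (-1) := by
      rw [hexpL, Real.exp_neg, div_le_iff₀ (by positivity), inv_mul_eq_div,
        le_div_iff₀ (Real.exp_pos _)]
      nlinarith [Real.exp_one_lt_d9, Real.exp_pos 1]
    linarith [Real.exp_le_exp.1 h2]
  -- With at most `12 * M ^ 3 * H * K` data sets the failures add up to `δ`. As `exp (-L)` has `48 =
  -- 4 * 12` in its denominator, up to `4 * |G| * |Pi|` terms `exp (-L)` fit into one data set's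
  -- budget.
  set η : ENNReal := ENNReal.ofReal (δ / (12 * (P.numStates : ℝ) ^ 3 * H * Fintype.card A)) with hη
  have hS : GlobalPolicy.Setup P prm Pi G fit η := by
    refine ⟨hP, hG, hcomp, hreal, hfit, ?_, ?_, ?_, ?_, ?_⟩
    · rw [hprm]; exact hτ0.le
    · intro t ht
      rw [hprm]
      change 3 * τ ≤ ((H : ℝ) - t) * (8 * τ + 3 * τ)
      have : (1 : ℝ) ≤ (H : ℝ) - t := by
        have : ((t + 1 : ℕ) : ℝ) ≤ H := by exact_mod_cast ht
        push_cast at this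
        linarith
      nlinarith
    · intro t ht
      rw [hprm]
      change ((H : ℝ) - (t + 1 : ℕ)) * (8 * τ + 3 * τ) + 8 * τ + 3 * τ ≤
        ((H : ℝ) - t) * (8 * τ + 3 * τ)
      push_cast
      linarith
    · intro π h p hp
      obtain ⟨E, h1, h2, h3⟩ := GlobalPolicy.exists_testAccurate_event (prm := prm) hP hG
        (τ := τ) (L := L) (by rw [hprm]; rfl) hτ0 (by linarith)
        (by rw [hprm]; exact Nat.le_ceil _) π h p hp
      refine ⟨E, h1, h2.trans (ENNReal.ofReal_le_ofReal ?_), h3⟩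
      rw [hexpL, ← mul_assoc, mul_div_assoc', div_le_div_iff₀ (by positivity) (by positivity)]
      have : ((G.card : ℝ) + 1) * 2 ≤ 4 * G.card * Pi.card := by nlinarith
      calc ((G.card : ℝ) + 1) * 2 * δ * (12 * (P.numStates : ℝ) ^ 3 * H * Fintype.card A)
          ≤ 4 * G.card * Pi.card * δ * (12 * (P.numStates : ℝ) ^ 3 * H * Fintype.card A) := by
            gcongr
        _ = _ := by ring
    · intro π h p hp
      obtain ⟨E, h1, h2, h3⟩ := GlobalPolicy.exists_trainAccurate_event (prm := prm) (Pi := Pi) hP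
        (τ := τ) (L := L) (by rw [hprm]; rfl) hτ0 hτ1 (by linarith)
        (by rw [hprm]; exact Nat.le_ceil _) π h p hp
      refine ⟨E, h1, h2.trans (ENNReal.ofReal_le_ofReal ?_), h3⟩
      rw [hexpL, ← mul_assoc, mul_div_assoc', div_le_div_iff₀ (by positivity) (by positivity)]
      have : (Pi.card : ℝ) * 2 ≤ 4 * G.card * Pi.card := by nlinarith
      calc (Pi.card : ℝ) * 2 * δ * (12 * (P.numStates : ℝ) ^ 3 * H * Fintype.card A)
          ≤ 4 * G.card * Pi.card * δ * (12 * (P.numStates : ℝ) ^ 3 * H * Fintype.card A) := by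
            gcongr
        _ = _ := by ring
  have hB1 : (1 : ℝ) ≤ (P.numStates : ℝ) ^ 3 * H * Fintype.card A :=
    one_le_mul_of_one_le_of_one_le (one_le_mul_of_one_le_of_one_le (one_le_pow₀ hMr) hHr) hKr
  have hη1 : η < 1 := by
    rw [hη, ENNReal.ofReal_lt_one, div_lt_one (by positivity)]
    linarith
  have hkey := GlobalPolicy.Prog.Ensures.le_prob
    (B := 12 * P.numStates ^ 3 * H * Fintype.card A) hη1 (hS.main hpol₀)
    (Good := fun π N => P.optValue - P.value π ≤ ε ∧
      (N : ℝ) ≤ 21054 * ((P.numStates : ℝ) ^ 3 * (H : ℝ) ^ 3 * Fintype.card A / ε ^ 2) *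
        Real.log (2 * P.numStates * H * Fintype.card A * Pi.card * G.card / δ))
    (fun π m N ⟨_, v, hv, hs⟩ => (GlobalPolicy.dataSets_le hM hH hK hv rfl hs).1)
    (fun π m N ⟨hπ, v, hv, hs⟩ => by
      refine ⟨hπ.trans_eq ?_, ?_⟩
      · rw [hprm]
        change ((H : ℝ) - (0 : ℕ)) * (8 * τ + 3 * τ) = ε
        rw [hτ]
        field_simp
        push_cast
        ring
      · have hN : (N : ℝ) ≤ 6 * (P.numStates : ℝ) ^ 3 * H * Fintype.card A * prm.nTest +
            (P.numStates : ℝ) ^ 2 * H * prm.nTrain := by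
          exact_mod_cast (GlobalPolicy.dataSets_le hM hH hK hv rfl hs).2
        refine (hN.trans (GlobalPolicy.trajectories_le hMr hHr hKr hL1 hε0 hε1 hτ
          (Nat.cast_nonneg _)
          (by rw [hprm]; exact (Nat.ceil_lt_add_one (by positivity)).le)
          (by rw [hprm]; exact (Nat.ceil_lt_add_one (by positivity)).le))).trans ?_
        have := GlobalPolicy.log_le_six_mul_log hMr hHr hKr hNPr hNGr hδ0 hδ1
        calc _ ≤ 3509 * ((P.numStates : ℝ) ^ 3 * (H : ℝ) ^ 3 * Fintype.card A / ε ^ 2) *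
              (6 * Real.log (2 * P.numStates * H * Fintype.card A * Pi.card * G.card / δ)) := by
              gcongr
          _ = _ := by ring)
  -- One sufficient recursion depth bounds the supremum over all depths from below.
  refine le_trans ?_ (hkey.trans (le_iSup (fun fuel =>
    (GlobalPolicy.main prm Pi G fit pol₀ fuel).prob P _ 0) _))
  rw [ENNReal.ofReal_sub _ hδ0.le, ENNReal.ofReal_one]
  refine tsub_le_tsub_left ?_ 1
  rw [Nat.sub_zero, hη, ← ENNReal.ofReal_natCast, ← ENNReal.ofReal_mul (by positivity)]
  refine ENNReal.ofReal_le_ofReal (le_of_eq ?_)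
  push_cast
  field_simp
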